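/- Let $\mathsf h$ and $\mathsf k$ be complex Hilbert spaces (inner products linear in the second variable). For $J\subset\mathbb R_+$ let $\mathcal F_J$ be the symmetric Fock space over $L^2(J;\mathsf k)$, put $\mathcal F=\mathcal F_{\mathbb R_+}$, and let $\varphi(f)=e^{-\frac12\|f\|^2}\big((n!)^{-1/2}f^{\otimes n}\big)_{n\ge0}$ be the normalised exponential vectors. Identify $\mathcal F$ with $\mathcal F_{[0,t[}\otimes\mathcal F_{[t,\infty[}$ through $\varphi(f)=\varphi(f|_{[0,t[})\otimes\varphi(f|_{[t,\infty[})$, let $\sigma_t$ be the ampliated CCR flow on $B(\mathsf h\otimes\mathcal F)$ (the right shift by $t$ carries $B(\mathsf h\otimes\mathcal F)$ onto $B(\mathsf h\otimes\mathcal F_{[t,\infty[})$, followed by ampliation with the identity of $\mathcal F_{[0,t[}$), and for $x\in\mathsf k$ let $x_{[0,t[}\in L^2(\mathbb R_+;\mathsf k)$ be equal to $x$ on $[0,t[$ and $0$ elsewhere. A left (respectively right) operator quantum stochastic cocycle on $\mathsf h$ is a family $X=(X_t)_{t\ge0}$ in $B(\mathsf h\otimes\mathcal F)$ such that $X_t\in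 B(\mathsf h\otimes\mathcal F_{[0,t[})\otimes I_{\mathcal F_{[t,\infty[}}$, $X_0=I$, and $X_{r+t}=X_r\,\sigma_r(X_t)$ (respectively $X_{r+t}=\sigma_r(X_t)X_r$) for all $r,t\ge0$. It is a positive contraction cocycle if $X_t\ge0$ and $\|X_t\|\le1$ for all $t$. Its associated semigroups are $X^{x,y}_t=E(x_{[0,t[})^*X_tE(y_{[0,t[})$, for $x,y\in\mathsf k$, where $E(f)u=u\otimes\varphi(f)$ for $u\in\mathsf h$. **Theorem.** Let $\mathsf T$ be a total subset of $\mathsf k$ containing $0$, and let $S=\{Q^{x,y}:x,y\in\mathsf T\}$ be a family of semigroups on $\mathsf h$, that is, $Q^{x,y}_t\in B(\mathsf h)$, $Q^{x,y}_0=I$ and $Q^{x,y}_{s+t}=Q^{x,y}_sQ^{x,y}_t$ for all $s,t\ge0$ (no continuity in $t$ is assumed). The following are equivalent. 1. There is a positive contraction left operator cocycle $X$ on $\mathsf h$ whose associated semigroups include $S$, that is, $X^{x,y}_t=Q^{x,y}_t$ for all $x,y\in\mathsf T$ and $t\ge0$. 2. There is a positive contraction right operator cocycle $X$ on $\mathsf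 h$ whose associated semigroups include $S$. 3. Both of the following conditions hold: (a) the operators $Q^{x,y}_t$ ($x,y\in\mathsf T$, $t\ge0$) all commute with each other; (b) $0\le Q^{\mathbf x}_t\le I_{\mathsf h}\otimes\varpi^{\mathbf x}_t$ for all $n\ge1$, $\mathbf x=(x_1,\dots,x_n)\in\mathsf T^n$ and $t\ge0$, where $Q^{\mathbf x}_t=[Q^{x_i,x_j}_t]_{i,j=1}^n\in B(\mathsf h^n)$ and $\varpi^{\mathbf x}_t=\big[e^{-t\chi(x_i,x_j)}\big]_{i,j=1}^n\in M_n(\mathbb C)$ with $\chi(u,v)=\tfrac12(\|u\|^2+\|v\|^2)-\langle u,v\rangle$. -/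

import Mathlib

open scoped TensorProduct InnerProductSpace NNReal

noncomputable section

namespace QSC

/-! ### Isometries determined by their values on a total family -/

section Gram

/-- If `a` is a total family in `E` and `b` is a family in `F` with the same Gram matrix, then
`a i ↦ b i` extends by linearity and continuity to an isometry `E → F`. -/
theorem exists_gramIsometry {ι E F : Type*} [NormedAddCommGroup E] [InnerProductSpace ℂ E]
    [NormedAddCommGroup F] [InnerProductSpace ℂ F] [CompleteSpace F] (a : ι → E) (b : ι → F)
    (ha : (Submodule.span ℂ (Set.range a)).topologicalClosure = ⊤)
    (hab : ∀ i j, ⟪b i, b j⟫_ℂ = ⟪a i, a j⟫_ℂ) :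
    ∃ U : E →ₗᵢ[ℂ] F, ∀ i, U (a i) = b i := by
  set p : (ι →₀ ℂ) →ₗ[ℂ] E := Finsupp.linearCombination ℂ a with hp
  set q : (ι →₀ ℂ) →ₗ[ℂ] F := Finsupp.linearCombination ℂ b with hq
  have hn : ∀ x, ‖q x‖ = ‖p x‖ := by
    intro x
    have h1 : ⟪q x, q x⟫_ℂ = ⟪p x, p x⟫_ℂ := by
      simp only [hp, hq, Finsupp.linearCombination_apply, Finsupp.sum, sum_inner, inner_sum,
        inner_smul_left, inner_smul_right, hab]
    have h2 := congrArg Complex.re h1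
    have h3 : ‖q x‖ ^ 2 = ‖p x‖ ^ 2 := by
      rw [← inner_self_eq_norm_sq (𝕜 := ℂ), ← inner_self_eq_norm_sq (𝕜 := ℂ)]
      exact h2
    exact (sq_eq_sq₀ (norm_nonneg _) (norm_nonneg _)).1 h3
  have hd : DenseRange p := by
    have : (LinearMap.range p) = Submodule.span ℂ (Set.range a) := Finsupp.range_linearCombination ℂ
    rw [DenseRange, ← LinearMap.coe_range, this, Submodule.dense_iff_topologicalClosure_eq_top]
    exact ha
  have hb : ∃ C, ∀ x, ‖q x‖ ≤ C * ‖p x‖ := ⟨1, fun x => by rw [hn, one_mul]⟩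
  have hU : ∀ x, ‖q.extendOfNorm p x‖ = ‖x‖ := by
    intro x
    refine hd.induction_on (p := fun x => ‖q.extendOfNorm p x‖ = ‖x‖) x ?_ ?_
    · exact isClosed_eq (by fun_prop) (by fun_prop)
    · intro y
      rw [LinearMap.extendOfNorm_eq hd hb, hn]
  refine ⟨⟨(q.extendOfNorm p).toLinearMap, hU⟩, fun i => ?_⟩
  have h := LinearMap.extendOfNorm_eq hd hb (Finsupp.single i 1)
  simpa [hp, hq] using h

variable {ι E F : Type*} [NormedAddCommGroup E] [InnerProductSpace ℂ E]
  [NormedAddCommGroup F] [InnerProductSpace ℂ F] [CompleteSpace F]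

/-- The isometry `E → F` determined by `a i ↦ b i`. -/
def gramIsometry (a : ι → E) (b : ι → F)
    (ha : (Submodule.span ℂ (Set.range a)).topologicalClosure = ⊤)
    (hab : ∀ i j, ⟪b i, b j⟫_ℂ = ⟪a i, a j⟫_ℂ) : E →ₗᵢ[ℂ] F :=
  (exists_gramIsometry a b ha hab).choose

theorem gramIsometry_apply (a : ι → E) (b : ι → F)
    (ha : (Submodule.span ℂ (Set.range a)).topologicalClosure = ⊤)
    (hab : ∀ i j, ⟪b i, b j⟫_ℂ = ⟪a i, a j⟫_ℂ) (i : ι) : gramIsometry a b ha hab (a i) = b i :=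
  (exists_gramIsometry a b ha hab).choose_spec i

end Gram

/-! ### Hilbert space tensor products -/

section Tensor

/-- The Hilbert space tensor product: the completion of the algebraic tensor product with respect
to the inner product `⟪u ⊗ v, u' ⊗ v'⟫ = ⟪u, u'⟫ ⟪v, v'⟫`. -/
def HTensor (E F : Type*) [NormedAddCommGroup E] [InnerProductSpace ℂ E]
    [NormedAddCommGroup F] [InnerProductSpace ℂ F] : Type _ :=
  UniformSpace.Completion (E ⊗[ℂ] F)

variable {E F : Type*} [NormedAddCommGroup E] [InnerProductSpace ℂ E]
  [NormedAddCommGroup F] [InnerProductSpace ℂ F]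

instance : NormedAddCommGroup (HTensor E F) :=
  inferInstanceAs (NormedAddCommGroup (UniformSpace.Completion (E ⊗[ℂ] F)))

instance : InnerProductSpace ℂ (HTensor E F) :=
  inferInstanceAs (InnerProductSpace ℂ (UniformSpace.Completion (E ⊗[ℂ] F)))

instance : CompleteSpace (HTensor E F) :=
  inferInstanceAs (CompleteSpace (UniformSpace.Completion (E ⊗[ℂ] F)))

/-- The canonical isometry of the algebraic tensor product into its completion. -/
def toHTensor : (E ⊗[ℂ] F) →ₗᵢ[ℂ] HTensor E F :=
  (UniformSpace.Completion.toComplₗᵢ : (E ⊗[ℂ] F) →ₗᵢ[ℂ] UniformSpace.Completion (E ⊗[ℂ] F))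

theorem denseRange_toHTensor : DenseRange (toHTensor : (E ⊗[ℂ] F) →ₗᵢ[ℂ] HTensor E F) :=
  UniformSpace.Completion.denseRange_coe

/-- The elementary tensor `u ⊗ v`. -/
def htmul (u : E) (v : F) : HTensor E F := toHTensor (u ⊗ₜ[ℂ] v)

theorem inner_htmul (u u' : E) (v v' : F) :
    ⟪htmul u v, htmul u' v'⟫_ℂ = ⟪u, u'⟫_ℂ * ⟪v, v'⟫_ℂ := by
  rw [htmul, htmul, LinearIsometry.inner_map_map, TensorProduct.inner_tmul]

/-- The operator `I ⊗ |v⟩ : u ↦ u ⊗ v`. -/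
def ketE (v : F) : E →L[ℂ] HTensor E F :=
  toHTensor.toContinuousLinearMap ∘L (TensorProduct.mkL ℂ E F).flip v

/-- The operator `|u⟩ ⊗ I : v ↦ u ⊗ v`. -/
def ketL (u : E) : F →L[ℂ] HTensor E F :=
  toHTensor.toContinuousLinearMap ∘L TensorProduct.mkL ℂ E F u

theorem ketE_apply (u : E) (v : F) : ketE v u = htmul u v := rfl

theorem ketL_apply (u : E) (v : F) : ketL u v = htmul u v := rfl

/-- The ampliation `A ⊗ I_F` of a bounded operator `A` on `E`. -/
def ampl (F : Type*) [NormedAddCommGroup F] [InnerProductSpace ℂ F] (A : E →L[ℂ] E) :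
    HTensor E F →L[ℂ] HTensor E F :=
  ((A.rTensor F).completion :
    UniformSpace.Completion (E ⊗[ℂ] F) →L[ℂ] UniformSpace.Completion (E ⊗[ℂ] F))

theorem ampl_toHTensor (A : E →L[ℂ] E) (x : E ⊗[ℂ] F) :
    ampl F A (toHTensor x) = toHTensor (A.rTensor F x) :=
  ContinuousLinearMap.completion_apply_coe _ _

theorem ampl_htmul (A : E →L[ℂ] E) (u : E) (v : F) :
    ampl F A (htmul u v) = htmul (A u) v :=
  ampl_toHTensor A (u ⊗ₜ[ℂ] v)

theorem span_htmul_eq_top {ι : Type*} (c : ι → F)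
    (hc : (Submodule.span ℂ (Set.range c)).topologicalClosure = ⊤) :
    (Submodule.span ℂ (Set.range fun p : E × ι => htmul p.1 (c p.2))).topologicalClosure = ⊤ := by
  set K := (Submodule.span ℂ (Set.range fun p : E × ι => htmul p.1 (c p.2))).topologicalClosure
    with hK
  have hKc : IsClosed (K : Set (HTensor E F)) := Submodule.isClosed_topologicalClosure _
  have h1 : ∀ (u : E) (v : F), htmul u v ∈ K := by
    intro u v
    have hcl : IsClosed ((K.comap (ketL (F := F) u).toLinearMap : Submodule ℂ F) : Set F) :=
      hKc.preimage (ketL (F := F) u).continuous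
    have hle : (Submodule.span ℂ (Set.range c)).topologicalClosure
        ≤ K.comap (ketL (F := F) u).toLinearMap := by
      refine Submodule.topologicalClosure_minimal _ ?_ hcl
      rw [Submodule.span_le]
      rintro _ ⟨i, rfl⟩
      exact Submodule.le_topologicalClosure _ (Submodule.subset_span ⟨(u, i), rfl⟩)
    rw [hc] at hle
    exact hle (Submodule.mem_top : v ∈ ⊤)
  have h2 : ∀ x : E ⊗[ℂ] F, toHTensor x ∈ K := by
    intro x
    induction x using TensorProduct.induction_on with
    | zero =>
      rw [map_zero]
      exact K.zero_mem
    | tmul u v => exact h1 u v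
    | add x y hx hy =>
      rw [map_add]
      exact K.add_mem hx hy
  exact eq_top_iff.2 fun x _ => denseRange_toHTensor.induction_on (p := (· ∈ K)) x hKc h2

end Tensor

/-! ### Symmetric Fock space -/

section Fock

/-- Bundled Hilbert spaces, used only for the recursive definition of the tensor powers. -/
structure HilbertSp where
  carrier : Type*
  [toNormed : NormedAddCommGroup carrier]
  [toInner : InnerProductSpace ℂ carrier]
  [toComplete : CompleteSpace carrier]

attribute [instance] HilbertSp.toNormed HilbertSp.toInner HilbertSp.toComplete

universe u

variable (H : Type u) [NormedAddCommGroup H] [InnerProductSpace ℂ H]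

/-- The full tensor powers: `H^{⊗0} = ℂ` and `H^{⊗(n+1)} = H^{⊗n} ⊗ H`. -/
def tensorPow : ℕ → HilbertSp.{u}
  | 0 => ⟨EuclideanSpace ℂ PUnit.{u + 1}⟩
  | n + 1 => ⟨HTensor (tensorPow n).carrier H⟩

variable {H}

/-- The product vector `f^{⊗n}`. -/
def powVec (f : H) : (n : ℕ) → (tensorPow H n).carrier
  | 0 => EuclideanSpace.single PUnit.unit (1 : ℂ)
  | n + 1 => htmul (E := (tensorPow H n).carrier) (powVec f n) f

theorem inner_powVec (f g : H) (n : ℕ) :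
    ⟪powVec f n, powVec g n⟫_ℂ = ⟪f, g⟫_ℂ ^ n := by
  induction n with
  | zero =>
    change ⟪EuclideanSpace.single PUnit.unit (1 : ℂ), EuclideanSpace.single PUnit.unit (1 : ℂ)⟫_ℂ = _
    simp
  | succ n ih =>
    change ⟪htmul (powVec f n) f, htmul (powVec g n) g⟫_ℂ = _
    rw [inner_htmul, ih, pow_succ]

variable (H)

/-- The symmetric tensor power: the closed linear span of the product vectors `f^{⊗n}`. -/
def symPow (n : ℕ) : Submodule ℂ (tensorPow H n).carrier :=
  (Submodule.span ℂ (Set.range fun f : H => powVec f n)).topologicalClosure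

instance (n : ℕ) : CompleteSpace (symPow H n) :=
  (Submodule.isClosed_topologicalClosure _).completeSpace_coe

/-- The symmetric Fock space over `H`: the Hilbert space direct sum of the symmetric tensor
powers of `H`. -/
def Fock : Type u := lp (fun n : ℕ => symPow H n) 2

instance : NormedAddCommGroup (Fock H) :=
  inferInstanceAs (NormedAddCommGroup (lp (fun n : ℕ => symPow H n) 2))

instance : InnerProductSpace ℂ (Fock H) :=
  inferInstanceAs (InnerProductSpace ℂ (lp (fun n : ℕ => symPow H n) 2))

instance : CompleteSpace (Fock H) :=
  inferInstanceAs (CompleteSpace (lp (fun n : ℕ => symPow H n) 2))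

variable {H}

/-- The `n`-particle component of an element of Fock space. -/
def component (ξ : Fock H) (n : ℕ) : symPow H n := (show lp (fun n : ℕ => symPow H n) 2 from ξ) n

theorem hasSum_inner_component (ξ η : Fock H) :
    HasSum (fun n => ⟪component ξ n, component η n⟫_ℂ) ⟪ξ, η⟫_ℂ :=
  lp.hasSum_inner (𝕜 := ℂ) (G := fun n : ℕ => symPow H n) ξ η

/-- `f^{⊗n}` as an element of the symmetric tensor power. -/
def symVec (f : H) (n : ℕ) : symPow H n :=
  ⟨powVec f n, Submodule.le_topologicalClosure _ (Submodule.subset_span ⟨f, rfl⟩)⟩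

theorem inner_symVec (f g : H) (n : ℕ) : ⟪symVec f n, symVec g n⟫_ℂ = ⟪f, g⟫_ℂ ^ n :=
  inner_powVec f g n

theorem norm_symVec (f : H) (n : ℕ) : ‖symVec f n‖ = ‖f‖ ^ n := by
  have h := inner_symVec f f n
  rw [inner_self_eq_norm_sq_to_K, inner_self_eq_norm_sq_to_K] at h
  have h2 : ‖symVec f n‖ ^ 2 = (‖f‖ ^ n) ^ 2 := by
    have : ((‖symVec f n‖ ^ 2 : ℝ) : ℂ) = (((‖f‖ ^ n) ^ 2 : ℝ) : ℂ) := by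
      push_cast
      rw [← pow_mul, mul_comm n 2, pow_mul]
      exact h
    exact_mod_cast this
  exact (sq_eq_sq₀ (norm_nonneg _) (by positivity)).1 h2

/-- The `n`-particle component `e^{-‖f‖²/2} (n!)^{-1/2} f^{⊗n}` of a coherent vector. -/
def coherentFun (f : H) (n : ℕ) : symPow H n :=
  ((Real.exp (-(‖f‖ ^ 2) / 2) * (Real.sqrt (n.factorial))⁻¹ : ℝ) : ℂ) • symVec f n

theorem inner_coherentFun (f g : H) (n : ℕ) :
    ⟪coherentFun f n, coherentFun g n⟫_ℂ =
      (Real.exp (-(‖f‖ ^ 2) / 2) * Real.exp (-(‖g‖ ^ 2) / 2) : ℝ) *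
        (⟪f, g⟫_ℂ ^ n / n.factorial) := by
  have h : ((Real.sqrt (n.factorial) : ℝ) : ℂ) * ((Real.sqrt (n.factorial) : ℝ) : ℂ)
      = (n.factorial : ℂ) := by
    rw [← Complex.ofReal_mul, Real.mul_self_sqrt (by positivity)]
    simp
  simp only [coherentFun, inner_smul_left, inner_smul_right, inner_symVec, Complex.conj_ofReal]
  rw [← h]
  push_cast
  simp only [div_eq_mul_inv, mul_inv]
  ring

theorem memlp_coherentFun (f : H) : Memℓp (coherentFun f) 2 := by
  have h : ∀ n, ‖coherentFun f n‖ ^ 2 =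
      Real.exp (-(‖f‖ ^ 2) / 2) ^ 2 * ((‖f‖ ^ 2) ^ n / n.factorial) := by
    intro n
    have hs : Real.sqrt (n.factorial) ^ 2 = (n.factorial : ℝ) := Real.sq_sqrt (by positivity)
    rw [coherentFun, norm_smul, norm_symVec, Complex.norm_real, Real.norm_eq_abs,
      abs_of_nonneg (by positivity), mul_pow, mul_pow, inv_pow, hs]
    ring
  refine memℓp_gen ?_
  simp only [ENNReal.toReal_ofNat, Real.rpow_ofNat, h]
  exact (Real.summable_pow_div_factorial _).mul_left _

/-- The normalised exponential (coherent) vector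
`e^{-‖f‖²/2} ((n!)^{-1/2} f^{⊗n})_{n ≥ 0}` in the symmetric Fock space over `H`. -/
def coherent (f : H) : Fock H :=
  (⟨coherentFun f, memlp_coherentFun f⟩ : lp (fun n : ℕ => symPow H n) 2)

/-- `χ(u, v) = (‖u‖² + ‖v‖²) / 2 - ⟪u, v⟫`. -/
def chi (u v : H) : ℂ := ((‖u‖ ^ 2 + ‖v‖ ^ 2) / 2 : ℝ) - ⟪u, v⟫_ℂ

theorem inner_coherent (f g : H) :
    ⟪coherent f, coherent g⟫_ℂ = Complex.exp (-chi f g) := by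
  have h1 : HasSum (fun n => ⟪coherentFun f n, coherentFun g n⟫_ℂ) ⟪coherent f, coherent g⟫_ℂ :=
    hasSum_inner_component (coherent f) (coherent g)
  simp only [inner_coherentFun] at h1
  have h2 : HasSum (fun n : ℕ => ⟪f, g⟫_ℂ ^ n / n.factorial) (Complex.exp ⟪f, g⟫_ℂ) := by
    rw [Complex.exp_eq_exp_ℂ]
    exact NormedSpace.expSeries_div_hasSum_exp ⟪f, g⟫_ℂ
  rw [h1.unique (h2.mul_left _), ← Real.exp_add, Complex.ofReal_exp, ← Complex.exp_add, chi]
  congr 1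
  push_cast
  ring

theorem span_coherent_eq_top :
    (Submodule.span ℂ (Set.range fun f : H => coherent f)).topologicalClosure = ⊤ := by
  rw [Submodule.topologicalClosure_eq_top_iff, Submodule.eq_bot_iff]
  intro ξ hξ
  have h0 : ∀ f : H, ⟪ξ, coherent f⟫_ℂ = 0 := fun f =>
    Submodule.inner_left_of_mem_orthogonal (Submodule.subset_span (Set.mem_range_self f)) hξ
  have hpow : ∀ (z : ℂ) (f : H) (n : ℕ), symVec (z • f) n = z ^ n • symVec f n := by
    intro z f n
    apply Subtype.ext
    change powVec (z • f) n = z ^ n • powVec f n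
    induction n with
    | zero => rw [pow_zero, one_smul]; rfl
    | succ n ih =>
      change htmul (powVec (z • f) n) (z • f) = z ^ (n + 1) • htmul (powVec f n) f
      rw [ih, ← ketE_apply, map_smul, ketE_apply, ← ketL_apply, map_smul, ketL_apply, smul_smul,
        pow_succ]
  have h1 : ∀ (f : H) (n : ℕ), ⟪component ξ n, symVec f n⟫_ℂ = 0 := by
    intro f n
    set c : ℕ → ℂ := fun n => ((Real.sqrt (n.factorial))⁻¹ : ℝ) * ⟪component ξ n, symVec f n⟫_ℂ with hc
    have hs : ∀ z : ℂ, HasSum (fun n => z ^ n * c n) 0 := by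
      intro z
      have hh : HasSum (fun n => ⟪component ξ n, coherentFun (z • f) n⟫_ℂ) ⟪ξ, coherent (z • f)⟫_ℂ :=
        hasSum_inner_component ξ (coherent (z • f))
      rw [h0] at hh
      have hh2 := hh.mul_left ((Real.exp (-(‖z • f‖ ^ 2) / 2) : ℝ) : ℂ)⁻¹
      rw [mul_zero] at hh2
      have hne : ((Real.exp (-(‖z • f‖ ^ 2) / 2) : ℝ) : ℂ) ≠ 0 := by
        exact_mod_cast (Real.exp_pos _).ne'
      have he : (fun n => z ^ n * c n) = fun n =>
          ((Real.exp (-(‖z • f‖ ^ 2) / 2) : ℝ) : ℂ)⁻¹ * ⟪component ξ n, coherentFun (z • f) n⟫_ℂ := by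
        funext n
        rw [coherentFun, inner_smul_right, hpow, inner_smul_right, hc, Complex.ofReal_mul]
        field_simp
      rw [he]
      exact hh2
    have hp : HasFPowerSeriesAt (fun _ : ℂ => (0 : ℂ)) (FormalMultilinearSeries.ofScalars ℂ c) 0 := by
      rw [hasFPowerSeriesAt_iff]
      refine Filter.Eventually.of_forall fun z => ?_
      simpa [FormalMultilinearSeries.coeff_ofScalars] using hs z
    have hz := hp.eq_zero
    rw [FormalMultilinearSeries.ofScalars_series_eq_zero] at hz
    have hcn := congrFun hz n
    simp only [hc, Pi.zero_apply, mul_eq_zero] at hcn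
    rcases hcn with h | h
    · exfalso
      have : (Real.sqrt (n.factorial))⁻¹ = 0 := by exact_mod_cast h
      have hpos : 0 < (Real.sqrt (n.factorial))⁻¹ := by positivity
      exact hpos.ne' this
    · exact h
  refine lp.ext (E := fun n : ℕ => symPow H n) (funext fun n => ?_)
  have hmem := (component ξ n).2
  set w : (tensorPow H n).carrier := (component ξ n).1 with hw
  have hle : symPow H n ≤ LinearMap.ker (innerSL ℂ w).toLinearMap := by
    refine Submodule.topologicalClosure_minimal _ ?_ ((innerSL ℂ w).isClosed_ker)
    rw [Submodule.span_le]
    rintro _ ⟨f, rfl⟩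
    exact h1 f n
  have h2 : ⟪w, w⟫_ℂ = 0 := hle hmem
  apply Subtype.ext
  exact inner_self_eq_zero.1 h2

end Fock

/-! ### Quantum stochastic operator processes -/

section Cocycle

open MeasureTheory Set

variable (k : Type*) [NormedAddCommGroup k] [InnerProductSpace ℂ k]

/-- `L²(J; k)` for a subset `J` of the real line, with Lebesgue measure. -/
abbrev L2 (J : Set ℝ) : Type _ := Lp k 2 (volume.restrict J)

/-- The symmetric Fock space over `L²(J; k)`. -/
abbrev FockOn (J : Set ℝ) : Type _ := Fock (L2 k J)

variable {k}

/-- Restriction of square-integrable functions on `ℝ₊` to a subset `J`. -/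
def restr {J : Set ℝ} (hJ : J ⊆ Ici 0) (f : L2 k (Ici 0)) : L2 k J :=
  ((Lp.memLp f).mono_measure (Measure.restrict_mono hJ le_rfl)).toLp f

theorem Ico_subset (t : ℝ≥0) : Ico 0 (t : ℝ) ⊆ Ici 0 := fun _ h => h.1

theorem Ici_subset (t : ℝ≥0) : Ici (t : ℝ) ⊆ Ici 0 := Ici_subset_Ici.2 t.2

theorem inner_restr {J : Set ℝ} (hJ : J ⊆ Ici 0) (f g : L2 k (Ici 0)) :
    ⟪restr hJ f, restr hJ g⟫_ℂ = ∫ s in J, ⟪f s, g s⟫_ℂ := by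
  rw [L2.inner_def]
  refine integral_congr_ae ?_
  filter_upwards [MemLp.coeFn_toLp ((Lp.memLp f).mono_measure (Measure.restrict_mono hJ le_rfl)),
    MemLp.coeFn_toLp ((Lp.memLp g).mono_measure (Measure.restrict_mono hJ le_rfl))] with s h1 h2
  simp only [restr, h1, h2]

theorem inner_split (t : ℝ≥0) (f g : L2 k (Ici 0)) :
    ⟪restr (Ico_subset t) f, restr (Ico_subset t) g⟫_ℂ +
      ⟪restr (Ici_subset t) f, restr (Ici_subset t) g⟫_ℂ = ⟪f, g⟫_ℂ := by
  have hint : IntegrableOn (fun s => ⟪f s, g s⟫_ℂ) (Ici 0) := L2.integrable_inner f g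
  have hu : Ico 0 (t : ℝ) ∪ Ici (t : ℝ) = Ici 0 := Ico_union_Ici_eq_Ici t.2
  have hd : Disjoint (Ico 0 (t : ℝ)) (Ici (t : ℝ)) := by
    rw [Set.disjoint_left]
    exact fun x hx hx' => absurd hx.2 (not_lt.2 hx')
  have hs := setIntegral_union hd measurableSet_Ici (hint.mono_set (Ico_subset t))
    (hint.mono_set (Ici_subset t))
  rw [hu] at hs
  rw [inner_restr, inner_restr, L2.inner_def]
  exact hs.symm

theorem measurePreserving_add (t : ℝ≥0) :
    MeasurePreserving (fun s : ℝ => s + t) (volume.restrict (Ici 0))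
      (volume.restrict (Ici (t : ℝ))) := by
  have h := (measurePreserving_add_right (volume : Measure ℝ) (t : ℝ)).restrict_preimage
    (measurableSet_Ici (a := (t : ℝ)))
  have he : (fun s : ℝ => s + t) ⁻¹' Ici (t : ℝ) = Ici 0 := by
    ext s; simp
  rwa [he] at h

/-- The adjoint right shift `(s_t^* f)(s) = f(s + t)` on `L²(ℝ₊; k)`. -/
def backShift (t : ℝ≥0) (f : L2 k (Ici 0)) : L2 k (Ici 0) :=
  Lp.compMeasurePreserving (fun s : ℝ => s + t) (measurePreserving_add t)
    (restr (Ici_subset t) f)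

theorem inner_backShift (t : ℝ≥0) (f g : L2 k (Ici 0)) :
    ⟪backShift t f, backShift t g⟫_ℂ =
      ⟪restr (Ici_subset t) f, restr (Ici_subset t) g⟫_ℂ := by
  have hL := (Lp.compMeasurePreservingₗᵢ (E := k) (p := 2) ℂ (fun s : ℝ => s + t)
    (measurePreserving_add t)).inner_map_map (restr (Ici_subset t) f) (restr (Ici_subset t) g)
  exact hL

/-- `x_{[0,t[}`: the function with constant value `x` on `[0,t[` and `0` elsewhere. -/
def stepVec (t : ℝ≥0) (x : k) : L2 k (Ici 0) :=
  indicatorConstLp 2 (measurableSet_Ico (a := (0 : ℝ)) (b := t))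
    ((Measure.restrict_apply_le _ _).trans_lt (by simp)).ne x

variable {h : Type*} [NormedAddCommGroup h] [InnerProductSpace ℂ h]

theorem norm_sq_eq_inner {E : Type*} [NormedAddCommGroup E] [InnerProductSpace ℂ E] (x : E) :
    ((‖x‖ ^ 2 : ℝ) : ℂ) = ⟪x, x⟫_ℂ := by
  rw [inner_self_eq_norm_sq_to_K]; push_cast; rfl

theorem chi_add {H H₁ H₂ : Type*} [NormedAddCommGroup H] [InnerProductSpace ℂ H]
    [NormedAddCommGroup H₁] [InnerProductSpace ℂ H₁]
    [NormedAddCommGroup H₂] [InnerProductSpace ℂ H₂] (p : H → H₁) (q : H → H₂)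
    (hpq : ∀ f g, ⟪p f, p g⟫_ℂ + ⟪q f, q g⟫_ℂ = ⟪f, g⟫_ℂ) (f g : H) :
    chi (p f) (p g) + chi (q f) (q g) = chi f g := by
  simp only [chi, Complex.ofReal_div, Complex.ofReal_add, norm_sq_eq_inner, ← hpq]
  ring

theorem gram_split {H H₁ H₂ : Type*} [NormedAddCommGroup H] [InnerProductSpace ℂ H]
    [NormedAddCommGroup H₁] [InnerProductSpace ℂ H₁]
    [NormedAddCommGroup H₂] [InnerProductSpace ℂ H₂] (p : H → H₁) (q : H → H₂)
    (hpq : ∀ f g, ⟪p f, p g⟫_ℂ + ⟪q f, q g⟫_ℂ = ⟪f, g⟫_ℂ) (i j : h × H) :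
    ⟪htmul (htmul i.1 (coherent (p i.2))) (coherent (q i.2)),
      htmul (htmul j.1 (coherent (p j.2))) (coherent (q j.2))⟫_ℂ =
    ⟪htmul i.1 (coherent i.2), htmul j.1 (coherent j.2)⟫_ℂ := by
  simp only [inner_htmul, inner_coherent]
  rw [mul_assoc, ← Complex.exp_add, ← chi_add p q hpq i.2 j.2, neg_add]

variable (k h) in
/-- The identification `h ⊗ 𝓕 = (h ⊗ 𝓕_{[0,t[}) ⊗ 𝓕_{[t,∞[}`, effected by
`u ⊗ φ(f) ↦ u ⊗ φ(f|_{[0,t[}) ⊗ φ(f|_{[t,∞[})`. -/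
def splitAt (t : ℝ≥0) : HTensor h (FockOn k (Ici 0)) →ₗᵢ[ℂ]
    HTensor (HTensor h (FockOn k (Ico 0 (t : ℝ)))) (FockOn k (Ici (t : ℝ))) :=
  gramIsometry (fun p : h × L2 k (Ici 0) => htmul p.1 (coherent p.2))
    (fun p => htmul (htmul p.1 (coherent (restr (Ico_subset t) p.2)))
      (coherent (restr (Ici_subset t) p.2)))
    (span_htmul_eq_top _ span_coherent_eq_top)
    (gram_split (restr (Ico_subset t)) (restr (Ici_subset t)) (inner_split t))

variable (k h) in
/-- The identification `h ⊗ 𝓕 = (h ⊗ 𝓕_{[t,∞[}) ⊗ 𝓕_{[0,t[} = (h ⊗ 𝓕) ⊗ 𝓕_{[0,t[}`, in which the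
right shift identifies `𝓕` with `𝓕_{[t,∞[}`. It is effected by
`u ⊗ φ(f) ↦ u ⊗ φ(s_t^* f) ⊗ φ(f|_{[0,t[})`. -/
def shiftSplitAt (t : ℝ≥0) : HTensor h (FockOn k (Ici 0)) →ₗᵢ[ℂ]
    HTensor (HTensor h (FockOn k (Ici 0))) (FockOn k (Ico 0 (t : ℝ))) :=
  gramIsometry (fun p : h × L2 k (Ici 0) => htmul p.1 (coherent p.2))
    (fun p => htmul (htmul p.1 (coherent (backShift t p.2)))
      (coherent (restr (Ico_subset t) p.2)))
    (span_htmul_eq_top _ span_coherent_eq_top)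
    (gram_split (backShift t) (restr (Ico_subset t)) fun f g => by
      rw [inner_backShift, add_comm, inner_split])

/-- A one-parameter semigroup of bounded operators on `h` (no continuity in `t` is assumed). -/
structure IsSemigroup (Q : ℝ≥0 → h →L[ℂ] h) : Prop where
  zero : Q 0 = 1
  add : ∀ s t, Q (s + t) = Q s * Q t

/-- The operator on the orthogonal sum `h^n` with matrix `[A i j]`. -/
def opMatrix {n : ℕ} (A : Fin n → Fin n → h →L[ℂ] h) :
    PiLp 2 (fun _ : Fin n => h) →L[ℂ] PiLp 2 (fun _ : Fin n => h) :=
  (PiLp.continuousLinearEquiv 2 ℂ (fun _ : Fin n => h)).symm.toContinuousLinearMap ∘L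
    ContinuousLinearMap.pi fun i => ∑ j, A i j ∘L PiLp.proj 2 (fun _ : Fin n => h) j

theorem opMatrix_apply {n : ℕ} (A : Fin n → Fin n → h →L[ℂ] h) (v : PiLp 2 fun _ : Fin n => h)
    (i : Fin n) : opMatrix A v i = ∑ j, A i j (v j) := by
  simp [opMatrix]

variable (h) in
/-- The operator `I ⊗ ϖ` on `h^n`, where `ϖ = [e^{-t χ(x_i, x_j)}]`. -/
def gramOp (t : ℝ≥0) {n : ℕ} (x : Fin n → k) :
    PiLp 2 (fun _ : Fin n => h) →L[ℂ] PiLp 2 (fun _ : Fin n => h) :=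
  opMatrix fun i j => Complex.exp (-((t : ℝ) : ℂ) * chi (x i) (x j)) • (1 : h →L[ℂ] h)

variable [CompleteSpace h]

/-- The ampliated CCR flow `σ_t` on `B(h ⊗ 𝓕)`: the operator `A` is shifted to
`h ⊗ 𝓕_{[t,∞[}` and then ampliated by the identity of `𝓕_{[0,t[}`. -/
def ccrFlow (t : ℝ≥0) (A : HTensor h (FockOn k (Ici 0)) →L[ℂ] HTensor h (FockOn k (Ici 0))) :
    HTensor h (FockOn k (Ici 0)) →L[ℂ] HTensor h (FockOn k (Ici 0)) :=
  (shiftSplitAt k h t).toContinuousLinearMap.adjoint ∘L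
    ampl (FockOn k (Ico 0 (t : ℝ))) A ∘L (shiftSplitAt k h t).toContinuousLinearMap

/-- The operator `Y ⊗ I_{[t,∞[}` on `h ⊗ 𝓕`, for `Y` in `B(h ⊗ 𝓕_{[0,t[})`. -/
def adaptedExt (t : ℝ≥0) (Y : HTensor h (FockOn k (Ico 0 (t : ℝ))) →L[ℂ]
      HTensor h (FockOn k (Ico 0 (t : ℝ)))) :
    HTensor h (FockOn k (Ici 0)) →L[ℂ] HTensor h (FockOn k (Ici 0)) :=
  (splitAt k h t).toContinuousLinearMap.adjoint ∘L
    ampl (FockOn k (Ici (t : ℝ))) Y ∘L (splitAt k h t).toContinuousLinearMap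

/-- A bounded quantum stochastic process on `h`: an adapted family `(X_t)` in `B(h ⊗ 𝓕)`, that is
`X_t ∈ B(h ⊗ 𝓕_{[0,t[}) ⊗ I_{[t,∞[}`. -/
def IsProcess (X : ℝ≥0 → HTensor h (FockOn k (Ici 0)) →L[ℂ] HTensor h (FockOn k (Ici 0))) : Prop :=
  ∀ t, ∃ Y, X t = adaptedExt t Y

/-- A (bounded) left quantum stochastic operator cocycle on `h`. -/
structure IsLeftCocycle
    (X : ℝ≥0 → HTensor h (FockOn k (Ici 0)) →L[ℂ] HTensor h (FockOn k (Ici 0))) : Prop where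
  process : IsProcess X
  zero : X 0 = 1
  add : ∀ r t, X (r + t) = X r * ccrFlow r (X t)

/-- A (bounded) right quantum stochastic operator cocycle on `h`. -/
structure IsRightCocycle
    (X : ℝ≥0 → HTensor h (FockOn k (Ici 0)) →L[ℂ] HTensor h (FockOn k (Ici 0))) : Prop where
  process : IsProcess X
  zero : X 0 = 1
  add : ∀ r t, X (r + t) = ccrFlow r (X t) * X r

/-- The family `X` consists of positive contractions. -/
def IsPositiveContractive
    (X : ℝ≥0 → HTensor h (FockOn k (Ici 0)) →L[ℂ] HTensor h (FockOn k (Ici 0))) : Prop :=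
  ∀ t, (X t).IsPositive ∧ ‖X t‖ ≤ 1

/-- The associated semigroups
`X^{x,y}_t = E(x_{[0,t[})^* X_t E(y_{[0,t[})`, where `E(f) u = u ⊗ φ(f)`. -/
def assocSemigroup (X : ℝ≥0 → HTensor h (FockOn k (Ici 0)) →L[ℂ] HTensor h (FockOn k (Ici 0)))
    (x y : k) (t : ℝ≥0) : h →L[ℂ] h :=
  (ketE (coherent (stepVec t x))).adjoint ∘L X t ∘L ketE (coherent (stepVec t y))

end Cocycle

end QSC

end

set_option linter.unusedSectionVars false

noncomputable section

/-! A positive operator is self-adjoint, and taking adjoints turns $X_r\,\sigma_r(X_t)$ into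
$\sigma_r(X_t)X_r$. So a positive family is a left cocycle exactly when it is a right cocycle
(`IsPositiveContractive.isRightCocycle_iff`).

From a cocycle to (a) and (b): let $f$ equal $x$ on $[0,r[$ and $x'$ on $[r,r+t[$, and let $g$ equal
$y$, then $y'$, on these intervals, both vanishing later. The cocycle law makes
$Q^{x,y}_rQ^{x',y'}_t$ the matrix element of $X_{r+t}$ between $\varphi(f)$ and $\varphi(g)$.
Self-adjointness of $X_{r+t}$, with $(Q^{x,y}_t)^*=Q^{y,x}_t$, identifies it also with the product
in the opposite order (`IsLeftCocycle.commute_assocSemigroup`). Condition (b) is $0\le X_t\le I$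
tested on the vectors $\sum_i v_i\otimes\varphi((x_i)_{[0,t[})$.

From (a) and (b) to a cocycle: for $\mathsf T$-valued simple functions $F,G$ put
$K_t(F,G)=\prod_{x,y}Q^{x,y}_{\tau(x,y)}$, where $\tau(x,y)$ is the time in $[0,t[$ at which
$(F,G)=(x,y)$. Commutativity makes the order of the factors irrelevant, so only occupation times
matter and no continuity in $t$ is needed. The Gram kernel of the coherent vectors is the same
product formed from $e^{-s\chi(x,y)}$ (`inner_coherent_path`). For finitely many paths both kernels
are entrywise products over the values of the joint path, and Schur products of positive operator
matrices with commuting entries are positive (`opMatrix_schur_nonneg`). Hence (b) gives $0\le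
K_t\le$ Gram kernel (`pathProd_mem_Icc`), and `exists_contraction_of_kernel` yields a positive
contraction on $\mathsf h\otimes\mathcal F_{[0,t[}$ with matrix elements $K_t$. The cocycle law is
additivity of occupation times together with translation invariance (`pathProd_add`).

The last ingredient is that coherent vectors of $\mathsf T$-valued simple functions are total
(`total_coherent_path`). Since $0\in\mathsf T$, every vector of the span of $\mathsf T$ is an affine
combination $\sum_q c_qx_q$. The exponential vector of a function with such values is a limit of
product vectors built from $\sum_q c_q\,e(x_q1_A)$ over finer and finer pieces $A$, by the limit
$(1+b/n+o(1/n))^n\to e^b$. -/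

namespace QSC

/-! ### Vectors and operators determined on total families -/

section Hilbert

variable {E F V : Type*} [NormedAddCommGroup E] [InnerProductSpace ℂ E]
  [NormedAddCommGroup F] [InnerProductSpace ℂ F]
  [NormedAddCommGroup V] [InnerProductSpace ℂ V]

theorem mem_topologicalClosure_top {ι : Type*} {a : ι → E}
    (ha : (Submodule.span ℂ (Set.range a)).topologicalClosure = ⊤) {p : Submodule ℂ E}
    (hp : IsClosed (p : Set E)) (h : ∀ i, a i ∈ p) (x : E) : x ∈ p := by
  have : (Submodule.span ℂ (Set.range a)).topologicalClosure ≤ p := by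
    refine Submodule.topologicalClosure_minimal _ ?_ hp
    rw [Submodule.span_le]
    rintro _ ⟨i, rfl⟩
    exact h i
  rw [ha] at this
  exact this Submodule.mem_top

theorem eq_of_inner_total {ι : Type*} {a : ι → E}
    (ha : (Submodule.span ℂ (Set.range a)).topologicalClosure = ⊤) {x y : E}
    (h : ∀ i, ⟪a i, x⟫_ℂ = ⟪a i, y⟫_ℂ) : x = y := by
  refine ext_inner_right ℂ fun v => ?_
  have hv : v ∈ LinearMap.ker (innerSL ℂ (x - y)).toLinearMap := by
    refine mem_topologicalClosure_top ha (innerSL ℂ (x - y)).isClosed_ker (fun i => ?_) v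
    have := congrArg (starRingEnd ℂ) (sub_eq_zero.2 (h i))
    rw [← inner_sub_right, inner_conj_symm, map_zero] at this
    exact this
  have : ⟪x - y, v⟫_ℂ = 0 := hv
  rwa [inner_sub_left, sub_eq_zero] at this

theorem clm_eq_of_total {G : Type*} [NormedAddCommGroup G] [NormedSpace ℂ G]
    {ι : Type*} {a : ι → E}
    (ha : (Submodule.span ℂ (Set.range a)).topologicalClosure = ⊤) {A B : E →L[ℂ] G}
    (h : ∀ i, A (a i) = B (a i)) : A = B := by
  ext v
  have hv : v ∈ LinearMap.ker (A - B).toLinearMap :=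
    mem_topologicalClosure_top ha (A - B).isClosed_ker
      (fun i => by simp [h i]) v
  have : (A - B) v = 0 := hv
  rwa [sub_apply, sub_eq_zero] at this

/-- The cocycle law and the initial condition are checked in this form, on coherent vectors of
paths. -/
theorem clm_eq_of_inner_total {ι κ : Type*} {a : ι → E} {b : κ → F}
    (ha : (Submodule.span ℂ (Set.range a)).topologicalClosure = ⊤)
    (hb : (Submodule.span ℂ (Set.range b)).topologicalClosure = ⊤) {A B : E →L[ℂ] F}
    (h : ∀ j i, ⟪b j, A (a i)⟫_ℂ = ⟪b j, B (a i)⟫_ℂ) : A = B :=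
  clm_eq_of_total ha fun i => eq_of_inner_total hb fun j => h j i

end Hilbert

/-! ### Operator matrices and their Schur products -/

section OpMatrix

open scoped ComplexOrder

variable {h : Type*} [NormedAddCommGroup h] [InnerProductSpace ℂ h]

theorem inner_opMatrix {n : ℕ} (A : Fin n → Fin n → h →L[ℂ] h) (u v : PiLp 2 fun _ : Fin n => h) :
    ⟪u, opMatrix A v⟫_ℂ = ∑ i, ∑ j, ⟪u i, A i j (v j)⟫_ℂ := by
  simp only [PiLp.inner_apply, opMatrix_apply, inner_sum]

theorem opMatrix_mul {n : ℕ} (A B : Fin n → Fin n → h →L[ℂ] h) :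
    opMatrix A * opMatrix B = opMatrix fun i j => ∑ l, A i l * B l j := by
  ext v i
  simp only [mul_apply_eq_comp, opMatrix_apply, map_sum, sum_apply]
  rw [Finset.sum_comm]

theorem opMatrix_sub {n : ℕ} (A B : Fin n → Fin n → h →L[ℂ] h) :
    opMatrix A - opMatrix B = opMatrix fun i j => A i j - B i j := by
  ext v i
  simp [opMatrix_apply, Finset.sum_sub_distrib]

theorem opMatrix_injective {n : ℕ} {A B : Fin n → Fin n → h →L[ℂ] h}
    (hAB : opMatrix A = opMatrix B) : A = B := by
  funext i j
  ext v
  have := congrArg (fun w : PiLp 2 (fun _ : Fin n => h) => w i)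
    (DFunLike.congr_fun hAB (PiLp.single 2 j v))
  simp only [opMatrix_apply, PiLp.single, Pi.single_apply] at this
  simpa [apply_ite, Finset.sum_ite_eq] using this

/-- Allows a square root obtained by functional calculus on $h^n$ to be handled entrywise. -/
theorem exists_eq_opMatrix {n : ℕ}
    (C : PiLp 2 (fun _ : Fin n => h) →L[ℂ] PiLp 2 (fun _ : Fin n => h)) :
    ∃ A : Fin n → Fin n → h →L[ℂ] h, C = opMatrix A := by
  refine ⟨fun i j => PiLp.proj 2 (fun _ : Fin n => h) i ∘L C ∘L
    (PiLp.continuousLinearEquiv 2 ℂ (fun _ : Fin n => h)).symm.toContinuousLinearMap ∘L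
      ContinuousLinearMap.single ℂ (fun _ : Fin n => h) j, ?_⟩
  ext v i
  have hv : v = ∑ j, (PiLp.continuousLinearEquiv 2 ℂ (fun _ : Fin n => h)).symm
      (Pi.single j (v j)) := by
    rw [← map_sum]
    ext i
    simp [Finset.sum_apply, Pi.single_apply]
  rw [opMatrix_apply]
  conv_lhs => rw [hv]
  simp [map_sum]

/-- The order on `ℂ` forces the quadratic form to be real, and over the complex field this already
gives self-adjointness. -/
theorem opMatrix_nonneg_iff {n : ℕ} (A : Fin n → Fin n → h →L[ℂ] h) :
    0 ≤ opMatrix A ↔ ∀ v : PiLp 2 (fun _ : Fin n => h),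
      0 ≤ ∑ i, ∑ j, ⟪v i, A i j (v j)⟫_ℂ := by
  rw [ContinuousLinearMap.nonneg_iff_isPositive]
  constructor
  · intro hA v
    rw [← inner_opMatrix]
    exact hA.inner_nonneg_right v
  · intro hA
    rw [ContinuousLinearMap.isPositive_iff_complex]
    intro v
    have h1 := hA v
    rw [← inner_opMatrix] at h1
    rw [Complex.le_def] at h1
    have h2 : ⟪opMatrix A v, v⟫_ℂ = starRingEnd ℂ ⟪v, opMatrix A v⟫_ℂ := (inner_conj_symm _ _).symm
    rw [h2]
    refine ⟨?_, by rw [RCLike.conj_re]; exact h1.1⟩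
    apply Complex.ext
    · simp
    · rw [Complex.ofReal_im, Complex.conj_im, ← h1.2]; simp

theorem opMatrix_le_iff {n : ℕ} (A B : Fin n → Fin n → h →L[ℂ] h) :
    opMatrix A ≤ opMatrix B ↔ 0 ≤ opMatrix fun i j => B i j - A i j := by
  rw [ContinuousLinearMap.le_def, opMatrix_sub, ContinuousLinearMap.nonneg_iff_isPositive]

variable [CompleteSpace h]

theorem opMatrix_adjoint {n : ℕ} (A : Fin n → Fin n → h →L[ℂ] h) :
    (opMatrix A).adjoint = opMatrix fun i j => (A j i).adjoint := by
  refine (ContinuousLinearMap.eq_adjoint_iff _ _).2 (fun u v => ?_) |>.symm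
  rw [← inner_conj_symm, inner_opMatrix, inner_opMatrix, map_sum, Finset.sum_comm]
  simp only [map_sum]
  refine Finset.sum_congr rfl fun i _ => Finset.sum_congr rfl fun j _ => ?_
  rw [inner_conj_symm, ContinuousLinearMap.adjoint_inner_left]

/-- Schur products of positive operator matrices with mutually commuting entries are positive. -/
theorem opMatrix_schur_nonneg {n : ℕ} {A B : Fin n → Fin n → h →L[ℂ] h}
    (hA : 0 ≤ opMatrix A) (hB : 0 ≤ opMatrix B)
    (hc : ∀ i j k l, Commute (A i j) (B k l)) : 0 ≤ opMatrix fun i j => A i j * B i j := by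
  -- The matrix of $A$ is $C^2$ with $C$ positive, so each entry of $A$ is a sum of products of
  -- entries of $C$.
  obtain ⟨C, hC⟩ := exists_eq_opMatrix (CFC.sqrt (opMatrix A))
  have hCsa : ∀ i j, (C i j).adjoint = C j i := by
    have h1 : (opMatrix C).adjoint = opMatrix C := by
      rw [← hC]
      exact (IsSelfAdjoint.of_nonneg (CFC.sqrt_nonneg (opMatrix A))).star_eq
    rw [opMatrix_adjoint] at h1
    intro i j
    exact congrFun (congrFun (opMatrix_injective h1) j) i
  have hCC : ∀ i j, A i j = ∑ l, C i l * C l j := by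
    have h1 : opMatrix C * opMatrix C = opMatrix A := by
      rw [← hC]
      exact CFC.sqrt_mul_sqrt_self _ hA
    rw [opMatrix_mul] at h1
    intro i j
    exact (congrFun (congrFun (opMatrix_injective h1) i) j).symm
  -- The diagonal matrix with the single entry $B_{kl}$ repeated commutes with the matrix of $A$,
  -- hence with its square root.
  have hCB : ∀ i j k l, Commute (C i j) (B k l) := by
    intro i j k l
    set D : Fin n → Fin n → h →L[ℂ] h := fun p q => if p = q then B k l else 0 with hD
    have h1 : Commute (opMatrix A) (opMatrix D) := by
      change opMatrix A * opMatrix D = opMatrix D * opMatrix A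
      rw [opMatrix_mul, opMatrix_mul]
      congr 1
      funext p q
      simp [hD, (hc p q k l).eq]
    have h2 : Commute (opMatrix C) (opMatrix D) := by
      rw [← hC]
      exact h1.cfcₙ_nnreal _
    have h3 : opMatrix C * opMatrix D = opMatrix D * opMatrix C := h2
    rw [opMatrix_mul, opMatrix_mul] at h3
    have h4 := congrFun (congrFun (opMatrix_injective h3) i) j
    rw [commute_iff_eq]
    simpa [hD] using h4
  rw [opMatrix_nonneg_iff] at hB ⊢
  intro v
  -- The form of the Schur product is a sum over $l$ of values of the form of $B$, at the vectors
  -- $(C_{li}v_i)_i$.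
  have h1 : ∑ i, ∑ j, ⟪v i, (A i j * B i j) (v j)⟫_ℂ =
      ∑ l, ∑ i, ∑ j, ⟪C l i (v i), B i j (C l j (v j))⟫_ℂ := by
    symm
    rw [Finset.sum_comm]
    refine Finset.sum_congr rfl fun i _ => ?_
    rw [Finset.sum_comm]
    refine Finset.sum_congr rfl fun j _ => ?_
    rw [hCC, Finset.sum_mul, sum_apply, inner_sum]
    refine Finset.sum_congr rfl fun l _ => ?_
    rw [mul_assoc, (hCB l j i j).eq, mul_apply_eq_comp,
      ← hCsa i l, ContinuousLinearMap.adjoint_inner_left]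
    rfl
  rw [h1]
  exact Finset.sum_nonneg fun l _ => hB (WithLp.toLp 2 fun i => C l i (v i))

/-- Entrywise $BB'-AA'=(B-A)A'+B(B'-A')$, and both terms are Schur products of positive matrices. In
the application the entries of $B$ are scalars, which is why they may be asked to commute with
everything. -/
theorem opMatrix_schur_mono {n : ℕ} {A A' B B' : Fin n → Fin n → h →L[ℂ] h}
    (hB : 0 ≤ opMatrix B) (hA' : 0 ≤ opMatrix A')
    (hAB : opMatrix A ≤ opMatrix B) (hAB' : opMatrix A' ≤ opMatrix B')
    (hc : ∀ i j k l, Commute (A i j) (A' k l)) (hc' : ∀ i j (C : h →L[ℂ] h), Commute (B i j) C) :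
    opMatrix (fun i j => A i j * A' i j) ≤ opMatrix fun i j => B i j * B' i j := by
  rw [opMatrix_le_iff] at hAB hAB'
  have h1 := opMatrix_schur_nonneg hAB hA' fun i j k l => (hc' i j _).sub_left (hc i j k l)
  have h2 := opMatrix_schur_nonneg hB hAB' fun i j k l => hc' i j _
  rw [opMatrix_nonneg_iff] at h1 h2
  rw [opMatrix_le_iff, opMatrix_nonneg_iff]
  intro v
  have h3 := add_nonneg (h1 v) (h2 v)
  rw [← Finset.sum_add_distrib] at h3
  refine h3.trans_eq (Finset.sum_congr rfl fun i _ => ?_)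
  rw [← Finset.sum_add_distrib]
  refine Finset.sum_congr rfl fun j _ => ?_
  rw [← inner_add_right, ← add_apply]
  congr 2
  noncomm_ring

end OpMatrix

/-! ### Positive contractions from dominated kernels -/

section Kernel

theorem finsupp_sum_eq_sum_fin {X V M : Type*} [Zero V] [AddCommMonoid M] (f : X →₀ V)
    (φ : X → V → M) : f.sum φ = ∑ i : Fin f.support.card,
      φ (f.support.equivFin.symm i) (f (f.support.equivFin.symm i)) := by
  rw [Finsupp.sum, ← Finset.sum_coe_sort,
    ← f.support.equivFin.symm.sum_comp (fun a : f.support => φ a (f a))]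

open scoped ComplexOrder

variable {X V E : Type*} [NormedAddCommGroup V] [InnerProductSpace ℂ V] [CompleteSpace V]
  [NormedAddCommGroup E] [InnerProductSpace ℂ E] [CompleteSpace E]

theorem isPositive_and_norm_adjoint_comp_self {F : Type*} [NormedAddCommGroup F]
    [InnerProductSpace ℂ F] [CompleteSpace F] {S : E →L[ℂ] F} (hS : ‖S‖ ≤ 1) :
    (S.adjoint ∘L S).IsPositive ∧ ‖S.adjoint ∘L S‖ ≤ 1 := by
  refine ⟨ContinuousLinearMap.isPositive_adjoint_comp_self S, ?_⟩
  rw [ContinuousLinearMap.norm_adjoint_comp_self]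
  exact mul_le_one₀ hS (norm_nonneg _) hS

theorem adjoint_eq_of_opMatrix_nonneg {A : Fin 2 → Fin 2 → V →L[ℂ] V} (hA : 0 ≤ opMatrix A)
    (i j : Fin 2) : (A j i).adjoint = A i j := by
  have h1 : (opMatrix A).adjoint = opMatrix A := (IsSelfAdjoint.of_nonneg hA).star_eq
  rw [opMatrix_adjoint] at h1
  exact congrFun (congrFun (opMatrix_injective h1) i) j

/-- A kernel dominated by the Gram kernel of a total family is implemented by a positive
contraction. -/
theorem exists_contraction_of_kernel (e : X → V →L[ℂ] E)
    (he : (Submodule.span ℂ (Set.range fun p : X × V => e p.1 p.2)).topologicalClosure = ⊤)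
    (K : X → X → V →L[ℂ] V)
    (hpos : ∀ (n : ℕ) (x : Fin n → X), 0 ≤ opMatrix fun i j => K (x i) (x j))
    (hle : ∀ (n : ℕ) (x : Fin n → X), (opMatrix fun i j => K (x i) (x j)) ≤
      opMatrix fun i j => (e (x i)).adjoint ∘L e (x j)) :
    ∃ A : E →L[ℂ] E, A.IsPositive ∧ ‖A‖ ≤ 1 ∧
      ∀ (x y : X) (u v : V), ⟪e x u, A (e y v)⟫_ℂ = ⟪u, K x y v⟫_ℂ := by
  -- Hermitian symmetry of the kernel is read off from the $2\times2$ matrices, positivity from the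
  -- support of a finitely supported family.
  have hK : (Matrix.of K).PosSemidef := by
    refine ((RKHS.posSemidef_tfae (K := Matrix.of K)).out 0 2 rfl rfl).2 ⟨?_, fun vv => ?_⟩
    · ext1 x y
      exact adjoint_eq_of_opMatrix_nonneg (hpos 2 ![x, y]) 0 1
    · simp only [finsupp_sum_eq_sum_fin]
      have h1 := (opMatrix_nonneg_iff _).1 (hpos _ fun i => vv.support.equivFin.symm i)
        (WithLp.toLp 2 fun i => vv (vv.support.equivFin.symm i))
      rw [Finset.sum_comm] at h1
      have h2 := (Complex.le_def.1 h1).1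
      rw [← RCLike.conj_re (K := ℂ)]
      simp only [map_sum, inner_conj_symm]
      simpa using h2
  have : Fact (Matrix.of K).PosSemidef := ⟨hK⟩
  -- The reproducing kernel space of $K$ supplies a factorisation $K(x,y)=b_x^*b_y$.
  set b : X → V →L[ℂ] RKHS.OfKernel (Matrix.of K) :=
    RKHS.kerFun (RKHS.OfKernel (Matrix.of K)) with hb
  have hbb : ∀ x y u v, ⟪b x u, b y v⟫_ℂ = ⟪u, K x y v⟫_ℂ := by
    intro x y u v
    rw [hb, RKHS.kerFun_inner, RKHS.kerFun_apply, RKHS.OfKernel.kernel_ofKernel]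
    rfl
  set p : (X →₀ V) →ₗ[ℂ] E := Finsupp.lsum ℂ fun x => (e x).toLinearMap with hp
  set q : (X →₀ V) →ₗ[ℂ] RKHS.OfKernel (Matrix.of K) :=
    Finsupp.lsum ℂ fun x => (b x).toLinearMap with hq
  -- Domination by the Gram kernel says exactly that $e_xv\mapsto b_xv$ is contractive on the span,
  -- so that it extends to a contraction $S$.
  have hn : ∀ f, ‖q f‖ ≤ 1 * ‖p f‖ := by
    intro f
    rw [one_mul]
    obtain ⟨n, x, v, hqf, hpf⟩ : ∃ (n : ℕ) (x : Fin n → X) (v : PiLp 2 fun _ : Fin n => V),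
        q f = ∑ i, b (x i) (v i) ∧ p f = ∑ i, e (x i) (v i) := by
      refine ⟨f.support.card, fun i => f.support.equivFin.symm i,
        WithLp.toLp 2 fun i => f (f.support.equivFin.symm i), ?_, ?_⟩
      · rw [hq, Finsupp.lsum_apply, finsupp_sum_eq_sum_fin]
        rfl
      · rw [hp, Finsupp.lsum_apply, finsupp_sum_eq_sum_fin]
        rfl
    have h1 := (opMatrix_nonneg_iff _).1 ((opMatrix_le_iff _ _).1 (hle n x)) v
    have h2 : ⟪p f, p f⟫_ℂ - ⟪q f, q f⟫_ℂ =
        ∑ i, ∑ j, ⟪v i, ((e (x i)).adjoint ∘L e (x j) - K (x i) (x j)) (v j)⟫_ℂ := by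
      rw [hqf, hpf]
      simp only [sum_inner, inner_sum, hbb, ← Finset.sum_sub_distrib, sub_apply, inner_sub_right,
        ContinuousLinearMap.comp_apply, ContinuousLinearMap.adjoint_inner_right]
      exact Finset.sum_comm
    rw [← h2] at h1
    have h3 := (Complex.le_def.1 h1).1
    rw [Complex.sub_re] at h3
    have h4 : ‖q f‖ ^ 2 ≤ ‖p f‖ ^ 2 := by
      rw [← inner_self_eq_norm_sq (𝕜 := ℂ), ← inner_self_eq_norm_sq (𝕜 := ℂ)]
      simpa using h3
    exact (sq_le_sq₀ (norm_nonneg _) (norm_nonneg _)).1 h4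
  have hd : DenseRange p := by
    have hr : Submodule.span ℂ (Set.range fun p : X × V => e p.1 p.2) ≤ LinearMap.range p := by
      rw [Submodule.span_le]
      rintro _ ⟨⟨x, v⟩, rfl⟩
      exact ⟨Finsupp.single x v, by simp [hp]⟩
    have h1 := Submodule.dense_iff_topologicalClosure_eq_top.2 he
    exact h1.mono hr
  set S := q.extendOfNorm p with hS
  have hSp : ∀ f, S (p f) = q f := fun f => LinearMap.extendOfNorm_eq hd ⟨1, hn⟩ f
  have hSe : ∀ x v, S (e x v) = b x v := by
    intro x v
    have := hSp (Finsupp.single x v)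
    simpa [hp, hq] using this
  have hS1 : ‖S‖ ≤ 1 := LinearMap.opNorm_extendOfNorm_le hd zero_le_one hn
  -- The required operator is $S^*S$.
  obtain ⟨h1, h2⟩ := isPositive_and_norm_adjoint_comp_self hS1
  refine ⟨_, h1, h2, fun x y u v => ?_⟩
  rw [ContinuousLinearMap.comp_apply, ContinuousLinearMap.adjoint_inner_right, hSe, hSe, hbb]

end Kernel

/-! ### Ampliations -/

section Tensor

variable {E F : Type*} [NormedAddCommGroup E] [InnerProductSpace ℂ E]
  [NormedAddCommGroup F] [InnerProductSpace ℂ F]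

theorem total_id : (Submodule.span ℂ (Set.range fun v : E => v)).topologicalClosure = ⊤ := by
  rw [eq_top_iff]
  exact fun x _ => Submodule.le_topologicalClosure _ (Submodule.subset_span ⟨x, rfl⟩)

theorem total_htmul_all :
    (Submodule.span ℂ (Set.range fun p : E × F => htmul p.1 p.2)).topologicalClosure = ⊤ :=
  span_htmul_eq_top (fun v : F => v) total_id

variable (F) in
theorem norm_ampl_le (A : E →L[ℂ] E) : ‖ampl F A‖ ≤ ‖A‖ := by
  refine ContinuousLinearMap.opNorm_le_bound _ (norm_nonneg _) fun x => ?_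
  refine denseRange_toHTensor.induction_on (p := fun x => ‖ampl F A x‖ ≤ ‖A‖ * ‖x‖) x ?_ ?_
  · exact isClosed_le (by fun_prop) (by fun_prop)
  · intro y
    rw [ampl_toHTensor, LinearIsometry.norm_map, LinearIsometry.norm_map]
    exact ((A.rTensor F).le_opNorm y).trans
      (mul_le_mul_of_nonneg_right (ContinuousLinearMap.norm_rTensor_le F A) (norm_nonneg _))

variable (F) in
theorem ampl_mul (A B : E →L[ℂ] E) : ampl F (A * B) = ampl F A * ampl F B :=
  clm_eq_of_total total_htmul_all fun p => by
    rw [mul_apply_eq_comp]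
    simp only [ampl_htmul]
    rfl

variable [CompleteSpace E]

variable (F) in
theorem ampl_adjoint (A : E →L[ℂ] E) : (ampl F A).adjoint = ampl F A.adjoint :=
  clm_eq_of_inner_total total_htmul_all total_htmul_all fun p q => by
    simp only [ContinuousLinearMap.adjoint_inner_right, ampl_htmul, inner_htmul]

variable (F) in
-- With $R=A^{1/2}$ one has $A\otimes I=(R\otimes I)^*(R\otimes I)$, because ampliation respects
-- products and adjoints.
theorem ampl_isPositive {A : E →L[ℂ] E} (hA : A.IsPositive) : (ampl F A).IsPositive := by
  have h0 := (ContinuousLinearMap.nonneg_iff_isPositive A).2 hA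
  have h1 : CFC.sqrt A * CFC.sqrt A = A := CFC.sqrt_mul_sqrt_self A h0
  have h2 : (CFC.sqrt A).adjoint = CFC.sqrt A :=
    (IsSelfAdjoint.of_nonneg (CFC.sqrt_nonneg A)).star_eq
  have h3 : ampl F A = (ampl F (CFC.sqrt A)).adjoint ∘L ampl F (CFC.sqrt A) := by
    rw [ampl_adjoint, h2]
    conv_lhs => rw [← h1, ampl_mul]
    rfl
  rw [h3]
  exact ContinuousLinearMap.isPositive_adjoint_comp_self _

end Tensor

/-! ### Occupation times and path products -/

section Occupation

open MeasureTheory Set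

variable {T ι M : Type*} [CommMonoid M]

/-- The time spent in the set `A` by the pair of paths `(F, G)` at `p`. -/
def occTime (A : Set ℝ) (F G : SimpleFunc ℝ T) (p : T × T) : ℝ≥0 :=
  (volume (F ⁻¹' {p.1} ∩ G ⁻¹' {p.2} ∩ A)).toNNReal

/-- The product over all pairs of values of `F` and `G` of `q x y s`, where `s` is the time spent
by the two paths at `(x, y)`. -/
def pathProd (q : T → T → ℝ≥0 → M) (A : Set ℝ) (F G : SimpleFunc ℝ T) : M :=
  ∏ p ∈ F.range ×ˢ G.range, q p.1 p.2 (occTime A F G p)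

theorem occTime_eq_zero {A : Set ℝ} {F G : SimpleFunc ℝ T} {p : T × T} (hp : p ∉ F.range ×ˢ G.range) :
    occTime A F G p = 0 := by
  have : F ⁻¹' {p.1} ∩ G ⁻¹' {p.2} ∩ A = ∅ := by
    rw [Set.eq_empty_iff_forall_notMem]
    rintro s ⟨⟨h1, h2⟩, _⟩
    refine hp (Finset.mem_product.2 ⟨?_, ?_⟩)
    · rw [← h1]; exact F.mem_range_self s
    · rw [← h2]; exact G.mem_range_self s
  simp [occTime, this]

/-- A pair of values that is never attained has occupation time $0$ and contributes the factor $1$.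
Products of different pairs of paths can thus be compared over one index set. -/
theorem pathProd_eq_prod {q : T → T → ℝ≥0 → M} (hq0 : ∀ x y, q x y 0 = 1) (A : Set ℝ)
    (F G : SimpleFunc ℝ T) {S : Finset (T × T)} (hS : F.range ×ˢ G.range ⊆ S) :
    pathProd q A F G = ∏ p ∈ S, q p.1 p.2 (occTime A F G p) :=
  Finset.prod_subset hS fun p _ hp => by rw [occTime_eq_zero hp, hq0]

theorem pathProd_eq_pathProd {q : T → T → ℝ≥0 → M} (hq0 : ∀ x y, q x y 0 = 1) {A A' : Set ℝ}
    {F G F' G' : SimpleFunc ℝ T} (h : ∀ p, occTime A F G p = occTime A' F' G' p) :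
    pathProd q A F G = pathProd q A' F' G' := by
  classical
  rw [pathProd_eq_prod hq0 A F G
      (Finset.subset_union_left (s₂ := F'.range ×ˢ G'.range)),
    pathProd_eq_prod hq0 A' F' G' (Finset.subset_union_right (s₁ := F.range ×ˢ G.range))]
  exact Finset.prod_congr rfl fun p _ => by rw [h]

theorem pathProd_congr {q : T → T → ℝ≥0 → M} (hq0 : ∀ x y, q x y 0 = 1) {A : Set ℝ}
    {F G F' G' : SimpleFunc ℝ T} (hF : ∀ s ∈ A, F s = F' s) (hG : ∀ s ∈ A, G s = G' s) :
    pathProd q A F G = pathProd q A F' G' := by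
  refine pathProd_eq_pathProd hq0 fun p => ?_
  unfold occTime
  congr 2
  ext s
  simp only [mem_inter_iff, mem_preimage, mem_singleton_iff]
  constructor
  · rintro ⟨⟨h1, h2⟩, h3⟩
    rw [hF s h3] at h1
    rw [hG s h3] at h2
    exact ⟨⟨h1, h2⟩, h3⟩
  · rintro ⟨⟨h1, h2⟩, h3⟩
    rw [← hF s h3] at h1
    rw [← hG s h3] at h2
    exact ⟨⟨h1, h2⟩, h3⟩

theorem measurableSet_occ {A : Set ℝ} (hA : MeasurableSet A) (F G : SimpleFunc ℝ T) (p : T × T) :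
    MeasurableSet (F ⁻¹' {p.1} ∩ G ⁻¹' {p.2} ∩ A) :=
  ((F.measurableSet_fiber _).inter (G.measurableSet_fiber _)).inter hA

theorem measure_inter_ne_top {A : Set ℝ} (hA : volume A ≠ ⊤) (B : Set ℝ) : volume (B ∩ A) ≠ ⊤ :=
  measure_ne_top_of_subset inter_subset_right hA

theorem pathProd_union {q : T → T → ℝ≥0 → M}
    (hq : ∀ x y s t, q x y (s + t) = q x y s * q x y t) {A B : Set ℝ}
    (hB : MeasurableSet B) (hAt : volume A ≠ ⊤) (hBt : volume B ≠ ⊤)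
    (hd : Disjoint A B) (F G : SimpleFunc ℝ T) :
    pathProd q (A ∪ B) F G = pathProd q A F G * pathProd q B F G := by
  unfold pathProd
  rw [← Finset.prod_mul_distrib]
  refine Finset.prod_congr rfl fun p _ => ?_
  rw [← hq]
  congr 1
  unfold occTime
  rw [inter_union_distrib_left, measure_union _ (measurableSet_occ hB F G p),
    ENNReal.toNNReal_add (measure_inter_ne_top hAt _) (measure_inter_ne_top hBt _)]
  exact hd.mono inter_subset_right inter_subset_right

/-- The path `s ↦ F (s + r)`. -/
def shiftPath (r : ℝ≥0) (F : SimpleFunc ℝ T) : SimpleFunc ℝ T := F.comp (fun s => s + r) (by fun_prop)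

theorem shiftPath_apply (r : ℝ≥0) (F : SimpleFunc ℝ T) (s : ℝ) : shiftPath r F s = F (s + r) := rfl

theorem pathProd_shiftPath {q : T → T → ℝ≥0 → M} (hq0 : ∀ x y, q x y 0 = 1)
    (r t : ℝ≥0) (F G : SimpleFunc ℝ T) :
    pathProd q (Ico 0 (t : ℝ)) (shiftPath r F) (shiftPath r G) =
      pathProd q (Ico (r : ℝ) ((r + t : ℝ≥0) : ℝ)) F G := by
  refine pathProd_eq_pathProd hq0 fun p => ?_
  unfold occTime
  rw [← (measurePreserving_add_right (volume : Measure ℝ) (r : ℝ)).measure_preimage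
    (measurableSet_occ measurableSet_Ico F G p).nullMeasurableSet]
  congr 2
  ext s
  simp only [mem_inter_iff, mem_preimage, mem_singleton_iff, shiftPath_apply, mem_Ico,
    NNReal.coe_add]
  refine and_congr_right fun _ => ⟨fun h => ⟨by linarith [h.1], by linarith [h.2]⟩,
    fun h => ⟨by linarith [h.1], by linarith [h.2]⟩⟩

/-- This is the cocycle law at the level of kernels: occupation times on $[0,r[$ and $[r,r+t[$ add
up, and Lebesgue measure is translation invariant. -/
theorem pathProd_add {q : T → T → ℝ≥0 → M} (hq0 : ∀ x y, q x y 0 = 1)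
    (hq : ∀ x y s t, q x y (s + t) = q x y s * q x y t) (r t : ℝ≥0) (F G : SimpleFunc ℝ T) :
    pathProd q (Ico 0 ((r + t : ℝ≥0) : ℝ)) F G = pathProd q (Ico 0 (r : ℝ)) F G *
      pathProd q (Ico 0 (t : ℝ)) (shiftPath r F) (shiftPath r G) := by
  rw [pathProd_shiftPath hq0, ← pathProd_union hq measurableSet_Ico (by simp) (by simp),
    Ico_union_Ico_eq_Ico (NNReal.coe_nonneg r) (NNReal.coe_le_coe.2 le_self_add)]
  rw [Set.disjoint_left]
  exact fun x hx hx' => absurd hx.2 (not_lt.2 hx'.1)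

theorem pathProd_const {q : T → T → ℝ≥0 → M} (hq0 : ∀ x y, q x y 0 = 1) (t : ℝ≥0) (x y : T)
    {F G : SimpleFunc ℝ T} (hF : ∀ s ∈ Ico 0 (t : ℝ), F s = x) (hG : ∀ s ∈ Ico 0 (t : ℝ), G s = y) :
    pathProd q (Ico 0 (t : ℝ)) F G = q x y t := by
  rw [pathProd_congr hq0 (F' := SimpleFunc.const ℝ x) (G' := SimpleFunc.const ℝ y) hF hG, pathProd,
    SimpleFunc.range_const, SimpleFunc.range_const, Finset.singleton_product_singleton,
    Finset.prod_singleton, occTime]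
  congr 1
  have h1 : (SimpleFunc.const ℝ x ⁻¹' {x} ∩ SimpleFunc.const ℝ y ⁻¹' {y} ∩ Ico 0 (t : ℝ)) =
      Ico 0 (t : ℝ) := by
    ext s
    simp
  rw [h1, Real.volume_Ico, sub_zero]
  simp

theorem map_sum_of_add {q : ℝ≥0 → M} (hq0 : q 0 = 1) (hq : ∀ s t, q (s + t) = q s * q t)
    (S : Finset ι) (τ : ι → ℝ≥0) : q (∑ z ∈ S, τ z) = ∏ z ∈ S, q (τ z) := by
  classical
  induction S using Finset.induction_on with
  | empty => simpa using hq0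
  | insert a S ha ih => rw [Finset.sum_insert ha, Finset.prod_insert ha, hq, ih]

/-- Different labels may yield the same pair of values; their times add, and the semigroup law
splits the factor accordingly. With $Z$ the joint path of finitely many paths, all entries of the
kernel matrix become products over the same index set. -/
theorem pathProd_eq_prod_label {q : T → T → ℝ≥0 → M} (hq0 : ∀ x y, q x y 0 = 1)
    (hq : ∀ x y s t, q x y (s + t) = q x y s * q x y t) {A : Set ℝ} (hA : MeasurableSet A)
    (hAt : volume A ≠ ⊤) (Z : SimpleFunc ℝ ι) (a b : ι → T) {F G : SimpleFunc ℝ T} (hF : ∀ s, F s = a (Z s))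
    (hG : ∀ s, G s = b (Z s)) :
    pathProd q A F G = ∏ z ∈ Z.range, q (a z) (b z) (volume (Z ⁻¹' {z} ∩ A)).toNNReal := by
  classical
  unfold pathProd
  have hmem : ∀ z ∈ Z.range, (a z, b z) ∈ F.range ×ˢ G.range := by
    intro z hz
    obtain ⟨s, rfl⟩ := SimpleFunc.mem_range.1 hz
    rw [Finset.mem_product, ← hF, ← hG]
    exact ⟨F.mem_range_self s, G.mem_range_self s⟩
  rw [← Finset.prod_fiberwise_of_maps_to hmem]
  refine Finset.prod_congr rfl fun p _ => ?_
  have h1 : ∏ z ∈ Z.range with (a z, b z) = p, q (a z) (b z) (volume (Z ⁻¹' {z} ∩ A)).toNNReal =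
      ∏ z ∈ Z.range with (a z, b z) = p, q p.1 p.2 (volume (Z ⁻¹' {z} ∩ A)).toNNReal := by
    refine Finset.prod_congr rfl fun z hz => ?_
    rw [← (Finset.mem_filter.1 hz).2]
  rw [h1, ← map_sum_of_add (hq0 _ _) (hq _ _)]
  congr 1
  rw [occTime, ← ENNReal.toNNReal_sum fun z _ => measure_inter_ne_top hAt _,
    ← measure_biUnion_finset]
  · congr 2
    ext s
    simp only [mem_inter_iff, mem_preimage, mem_singleton_iff, hF, hG, mem_iUnion,
      Finset.mem_filter, exists_prop, SimpleFunc.mem_range, mem_range, Prod.ext_iff]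
    constructor
    · rintro ⟨h1, h2⟩
      exact ⟨Z s, ⟨⟨s, rfl⟩, h1⟩, rfl, h2⟩
    · rintro ⟨z, ⟨_, h1⟩, rfl, h2⟩
      exact ⟨h1, h2⟩
  · intro z _ z' _ hzz
    refine Set.disjoint_left.2 fun s h1 h2 => hzz ?_
    rw [← h1.1, ← h2.1]
  · exact fun z _ => (Z.measurableSet_fiber z).inter hA

/-- The path of a finite family of paths. -/
def jointPath {n : ℕ} (F : Fin n → SimpleFunc ℝ T) : SimpleFunc ℝ (Fin n → T) where
  toFun s i := F i s
  measurableSet_fiber' z := by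
    have : (fun (s : ℝ) (i : Fin n) => F i s) ⁻¹' {z} = ⋂ i, F i ⁻¹' {z i} := by
      ext s
      simp [funext_iff]
    rw [this]
    exact MeasurableSet.iInter fun i => (F i).measurableSet_fiber _
  finite_range' := by
    refine (Set.Finite.pi' fun i => (F i).finite_range).subset ?_
    rintro _ ⟨s, rfl⟩ i
    exact ⟨s, rfl⟩

theorem integral_pair {A : Set ℝ} (hAt : volume A ≠ ⊤) (F G : SimpleFunc ℝ T)
    (g : T → T → ℂ) :
    ∫ s in A, g (F s) (G s) =
      ∑ p ∈ F.range ×ˢ G.range, ((occTime A F G p : ℝ) : ℂ) * g p.1 p.2 := by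
  classical
  have hm : ∀ p : T × T, MeasurableSet (F ⁻¹' {p.1} ∩ G ⁻¹' {p.2}) := fun p =>
    (F.measurableSet_fiber _).inter (G.measurableSet_fiber _)
  have h1 : ∀ s, g (F s) (G s) = ∑ p ∈ F.range ×ˢ G.range,
      (F ⁻¹' {p.1} ∩ G ⁻¹' {p.2}).indicator (fun _ => g p.1 p.2) s := by
    intro s
    rw [Finset.sum_eq_single (F s, G s)]
    · simp
    · rintro p _ hp
      refine Set.indicator_of_notMem (fun h => hp ?_) _
      exact Prod.ext h.1.symm h.2.symm
    · intro h
      exact absurd (Finset.mem_product.2 ⟨F.mem_range_self s, G.mem_range_self s⟩) h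
  have : IsFiniteMeasure (volume.restrict A) := ⟨by simpa using hAt.lt_top⟩
  simp_rw [h1]
  rw [integral_finsetSum _ fun p _ => (integrable_const _).indicator (hm p)]
  refine Finset.sum_congr rfl fun p _ => ?_
  rw [integral_indicator (hm p), setIntegral_const, measureReal_restrict_apply (hm p), occTime,
    Complex.real_smul]
  rfl

end Occupation

/-! ### Square-integrable functions given by representatives -/

section L2

open MeasureTheory Set

variable {k : Type*} [NormedAddCommGroup k] [InnerProductSpace ℂ k]

/-- The element of `L²(J; k)` represented by a square-integrable function (and `0` for other
functions). -/
def toL2 (J : Set ℝ) (f : ℝ → k) : L2 k J :=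
  open Classical in if hf : MemLp f 2 (volume.restrict J) then hf.toLp f else 0

theorem toL2_eq {J : Set ℝ} {f : ℝ → k} (hf : MemLp f 2 (volume.restrict J)) :
    toL2 J f = hf.toLp f := dif_pos hf

theorem coeFn_toL2 {J : Set ℝ} {f : ℝ → k} (hf : MemLp f 2 (volume.restrict J)) :
    toL2 J f =ᵐ[volume.restrict J] f := by
  rw [toL2_eq hf]
  exact hf.coeFn_toLp

theorem inner_toL2 {J : Set ℝ} {f g : ℝ → k} (hf : MemLp f 2 (volume.restrict J))
    (hg : MemLp g 2 (volume.restrict J)) : ⟪toL2 J f, toL2 J g⟫_ℂ = ∫ s in J, ⟪f s, g s⟫_ℂ := by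
  rw [L2.inner_def]
  refine integral_congr_ae ?_
  filter_upwards [coeFn_toL2 hf, coeFn_toL2 hg] with s h1 h2
  rw [h1, h2]

theorem restr_toL2 {J : Set ℝ} (hJ : J ⊆ Ici 0) {f : ℝ → k}
    (hf : MemLp f 2 (volume.restrict (Ici 0))) : restr hJ (toL2 (Ici 0) f) = toL2 J f := by
  have hf' := hf.mono_measure (Measure.restrict_mono hJ (le_refl volume))
  refine Lp.ext ?_
  filter_upwards [coeFn_toL2 hf', ae_mono (Measure.restrict_mono hJ le_rfl) (coeFn_toL2 hf),
    MemLp.coeFn_toLp ((Lp.memLp (toL2 (Ici 0) f)).mono_measure (Measure.restrict_mono hJ le_rfl))]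
    with s h1 h2 h3
  rw [h1, ← h2]
  exact h3

theorem toL2_coeFn {J : Set ℝ} (f : L2 k J) : toL2 J f = f := by
  rw [toL2_eq (Lp.memLp f)]
  exact Lp.toLp_coeFn f _

theorem toL2_congr {J : Set ℝ} (hJ : MeasurableSet J) {f g : ℝ → k} (hfg : ∀ s ∈ J, f s = g s)
    (hf : MemLp f 2 (volume.restrict J)) : toL2 J f = toL2 J g := by
  have h : f =ᵐ[volume.restrict J] g := by
    filter_upwards [ae_restrict_mem hJ] with s hs using hfg s hs
  rw [toL2_eq hf, toL2_eq ((memLp_congr_ae h).1 hf)]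
  exact MemLp.toLp_congr _ _ h

theorem memLp_shift {f : ℝ → k} (t : ℝ≥0) (hf : MemLp f 2 (volume.restrict (Ici 0))) :
    MemLp (fun s => f (s + t)) 2 (volume.restrict (Ici 0)) :=
  (hf.mono_measure (Measure.restrict_mono (Ici_subset t) le_rfl)).comp_measurePreserving
    (measurePreserving_add t)

theorem backShift_toL2 (t : ℝ≥0) {f : ℝ → k} (hf : MemLp f 2 (volume.restrict (Ici 0))) :
    backShift t (toL2 (Ici 0) f) = toL2 (Ici 0) fun s => f (s + t) := by
  have hf' := hf.mono_measure (Measure.restrict_mono (Ici_subset t) (le_refl volume))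
  unfold backShift
  rw [restr_toL2 _ hf, toL2_eq hf', toL2_eq (memLp_shift t hf),
    Lp.toLp_compMeasurePreserving]
  rfl

theorem stepVec_eq (t : ℝ≥0) (x : k) :
    stepVec t x = toL2 (Ici 0) ((Ico 0 (t : ℝ)).indicator fun _ => x) := by
  have hμ : volume.restrict (Ici (0 : ℝ)) (Ico 0 (t : ℝ)) ≠ ⊤ :=
    ((Measure.restrict_apply_le _ _).trans_lt (by simp)).ne
  rw [toL2_eq (memLp_indicator_const 2 measurableSet_Ico x (Or.inr hμ))]
  rfl

/-- Expressed by inner products alone, so that the integral formulas for them apply to every term.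
-/
theorem chi_eq {H : Type*} [NormedAddCommGroup H] [InnerProductSpace ℂ H] (f g : H) :
    chi f g = (⟪f, f⟫_ℂ + ⟪g, g⟫_ℂ) / 2 - ⟪f, g⟫_ℂ := by
  rw [chi, Complex.ofReal_div, Complex.ofReal_add, norm_sq_eq_inner, norm_sq_eq_inner]
  simp

end L2

/-! ### Splitting a set into pieces of equal measure -/

section Splitting

open MeasureTheory Set Filter Topology

/-- The function $s\mapsto|B\cap\,]-\infty,s]|$ is 1-Lipschitz and tends to $0$ and to $|B|$ at the
two ends, so the intermediate value theorem applies. -/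
theorem exists_measureReal_inter_Iic_eq {B : Set ℝ} (hB : volume B ≠ ⊤) {v : ℝ}
    (hv : 0 < v) (hv' : v < volume.real B) : ∃ s, volume.real (B ∩ Iic s) = v := by
  have hfin : ∀ C, volume (B ∩ C) ≠ ⊤ := fun C => measure_ne_top_of_subset inter_subset_left hB
  set f : ℝ → ℝ := fun s => volume.real (B ∩ Iic s) with hf
  have hcont : Continuous f := by
    refine (LipschitzWith.of_le_add fun x y => ?_).continuous
    rcases le_total x y with hxy | hxy
    · have : f x ≤ f y := measureReal_mono (inter_subset_inter_right _ (Iic_subset_Iic.2 hxy))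
        (hfin _)
      linarith [dist_nonneg (x := x) (y := y)]
    · have h1 : B ∩ Iic x ⊆ (B ∩ Iic y) ∪ Ioc y x := fun s hs => by
        by_cases h : s ≤ y
        · exact Or.inl ⟨hs.1, h⟩
        · exact Or.inr ⟨not_le.1 h, hs.2⟩
      have h2 : f x ≤ volume.real ((B ∩ Iic y) ∪ Ioc y x) := measureReal_mono h1
        (measure_union_ne_top (hfin _) (by simp))
      refine h2.trans ((measureReal_union_le _ _).trans ?_)
      rw [Real.volume_real_Ioc_of_le hxy, Real.dist_eq, abs_of_nonneg (sub_nonneg.2 hxy)]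
  have : IsFiniteMeasure (volume.restrict B) := ⟨by simpa using hB.lt_top⟩
  have hr : ∀ C, MeasurableSet C → (volume.restrict B).real C = volume.real (B ∩ C) := fun C hC => by
    rw [measureReal_restrict_apply hC, inter_comm]
  have hu : (volume.restrict B).real univ = volume.real B := by simp
  refine mem_range_of_exists_le_of_exists_ge hcont ?_ ?_
  · have h1 : Tendsto (fun a : ℝ => (volume.restrict B).real (Ici a)) atBot
        (𝓝 ((volume.restrict B).real univ)) :=
      (ENNReal.tendsto_toReal (measure_ne_top _ _)).comp (tendsto_measure_Ici_atBot _)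
    rw [hu] at h1
    obtain ⟨a, ha⟩ := (h1.eventually (lt_mem_nhds (sub_lt_self _ hv))).exists
    refine ⟨a - 1, ?_⟩
    have h2 : volume.real (B ∩ Iic (a - 1)) + volume.real (B ∩ Ici a) ≤ volume.real B := by
      rw [← hr _ measurableSet_Iic, ← hr _ measurableSet_Ici, ← hu,
        ← measureReal_union (Set.disjoint_left.2 fun s h1 h2 => ?_) measurableSet_Ici]
      · exact measureReal_mono (subset_univ _)
      · have h3 : s ≤ a - 1 := h1
        have h4 : a ≤ s := h2
        linarith
    rw [hr _ measurableSet_Ici] at ha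
    change volume.real (B ∩ Iic (a - 1)) ≤ v
    linarith
  · have h1 : Tendsto (fun a : ℝ => (volume.restrict B).real (Iic a)) atTop
        (𝓝 ((volume.restrict B).real univ)) :=
      (ENNReal.tendsto_toReal (measure_ne_top _ _)).comp (tendsto_measure_Iic_atTop _)
    rw [hu] at h1
    obtain ⟨b, hb⟩ := (h1.eventually (lt_mem_nhds hv')).exists
    rw [hr _ measurableSet_Iic] at hb
    exact ⟨b, hb.le⟩

/-- A set of finite Lebesgue measure is the union of `n + 1` disjoint sets of equal measure. -/
theorem exists_equal_splitting (n : ℕ) : ∀ {B : Set ℝ}, MeasurableSet B → volume B ≠ ⊤ →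
    ∃ c : SimpleFunc ℝ (Fin (n + 1)), ∀ j,
      volume.real (B ∩ c ⁻¹' {j}) = volume.real B / (n + 1) := by
  induction n with
  | zero =>
    intro B _ _
    refine ⟨SimpleFunc.const ℝ 0, fun j => ?_⟩
    have : B ∩ SimpleFunc.const ℝ (0 : Fin 1) ⁻¹' {j} = B := by
      ext s
      have hj : j = 0 := Subsingleton.elim (α := Fin 1) j 0
      simp [hj]
    rw [this]
    simp
  | succ n ih =>
    intro B hBm hB
    have hfin : ∀ C, volume (B ∩ C) ≠ ⊤ := fun C => measure_ne_top_of_subset inter_subset_left hB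
    rcases (measureReal_nonneg (μ := volume) (s := B)).eq_or_lt with h0 | h0
    · refine ⟨SimpleFunc.const ℝ 0, fun j => ?_⟩
      rw [← h0, zero_div]
      exact le_antisymm (h0 ▸ measureReal_mono inter_subset_left hB) measureReal_nonneg
    -- Cut off the fraction $1/(n+2)$ on the left as colour $0$; the induction hypothesis colours
    -- the rest with the successors.
    · obtain ⟨s, hs⟩ := exists_measureReal_inter_Iic_eq hB
        (v := volume.real B / ((n + 1 : ℕ) + 1)) (by positivity)
        (div_lt_self h0 (by norm_cast; omega))
      obtain ⟨c, hc⟩ := ih (hBm.inter measurableSet_Ioi) (hfin (Ioi s))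
      have hsum : volume.real (B ∩ Iic s) + volume.real (B ∩ Ioi s) = volume.real B := by
        have hd : Disjoint (B ∩ Iic s) (B ∩ Ioi s) :=
          Set.disjoint_left.2 fun x h1 h2 => not_lt.2 (mem_Iic.1 h1.2) (mem_Ioi.1 h2.2)
        rw [← measureReal_union hd
          (hBm.inter measurableSet_Ioi) (hfin _) (hfin _), ← inter_union_distrib_left,
          Iic_union_Ioi, inter_univ]
      have hrest : volume.real (B ∩ Ioi s) / (n + 1) = volume.real B / ((n + 1 : ℕ) + 1) := by
        have : volume.real (B ∩ Ioi s) = volume.real B - volume.real B / ((n + 1 : ℕ) + 1) := by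
          linarith
        rw [this]
        push_cast
        field_simp
        ring
      refine ⟨SimpleFunc.piecewise (Iic s) measurableSet_Iic (SimpleFunc.const ℝ 0)
        (c.map Fin.succ), fun j => ?_⟩
      refine Fin.cases ?_ (fun j => ?_) j
      · rw [← hs]
        congr 1
        ext x
        by_cases hx : x ≤ s <;> simp [hx]
      · rw [← hrest, ← hc j]
        congr 1
        ext x
        by_cases hx : x ≤ s
        · simp [hx, (Fin.succ_ne_zero j).symm, not_lt.2 hx]
        · simp [hx, not_le.1 hx]

end Splitting

/-! ### Step functions on labelled partitions -/

section Label

open MeasureTheory Set Filter Topology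

variable {k : Type*} [NormedAddCommGroup k] [InnerProductSpace ℂ k] {ι : Type*} [Fintype ι]

/-- A measurable partition of `J`, up to the set with label `none`, into sets of finite measure. -/
structure IsLabelling (J : Set ℝ) (Z : SimpleFunc ℝ (Option ι)) : Prop where
  subset : ∀ i, Z ⁻¹' {some i} ⊆ J
  ne_top : ∀ i, volume (Z ⁻¹' {some i}) ≠ ⊤

/-- The step function with value `w i` on the set with label `i`. -/
def labelFun (Z : SimpleFunc ℝ (Option ι)) (w : ι → k) : SimpleFunc ℝ k :=
  Z.map fun o => o.elim 0 w

theorem memLp_labelFun {J : Set ℝ} {Z : SimpleFunc ℝ (Option ι)} (hZ : IsLabelling J Z)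
    (w : ι → k) {μ : Measure ℝ} (hμ : μ ≤ volume) : MemLp (labelFun Z w) 2 μ := by
  refine SimpleFunc.memLp_of_finite_measure_preimage 2 fun y hy => ?_
  have h1 : labelFun Z w ⁻¹' {y} ⊆ ⋃ i ∈ (Finset.univ : Finset ι), Z ⁻¹' {some i} := by
    intro s hs
    have hs' : (Z s).elim 0 w = y := hs
    rcases h : Z s with _ | i
    · rw [h] at hs'
      exact absurd hs'.symm hy
    · simp [h]
  refine (measure_mono h1).trans_lt ((hμ _).trans_lt ?_)
  exact (measure_biUnion_finset_le _ _).trans_lt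
    (ENNReal.sum_lt_top.2 fun i _ => (hZ.ne_top i).lt_top)

theorem inner_labelFun {J : Set ℝ} {Z : SimpleFunc ℝ (Option ι)}
    (hZ : IsLabelling J Z) (v w : ι → k) :
    ⟪toL2 J (labelFun Z v), toL2 J (labelFun Z w)⟫_ℂ =
      ∑ i, ((volume.real (Z ⁻¹' {some i}) : ℝ) : ℂ) * ⟪v i, w i⟫_ℂ := by
  classical
  have hm : ∀ i, MeasurableSet (Z ⁻¹' {some i}) := fun i => Z.measurableSet_fiber _
  rw [inner_toL2 (memLp_labelFun hZ v Measure.restrict_le_self)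
    (memLp_labelFun hZ w Measure.restrict_le_self)]
  have h1 : ∀ s, ⟪labelFun Z v s, labelFun Z w s⟫_ℂ =
      ∑ i, (Z ⁻¹' {some i}).indicator (fun _ => ⟪v i, w i⟫_ℂ) s := by
    intro s
    change ⟪(Z s).elim 0 v, (Z s).elim 0 w⟫_ℂ = _
    rcases h : Z s with _ | i
    · simp [h]
    · rw [Finset.sum_eq_single i]
      · simp [h]
      · intro j _ hj
        refine Set.indicator_of_notMem (fun h' => hj ?_) _
        have h'' : Z s = some j := h'
        rw [h] at h''
        exact (Option.some.inj h'').symm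
      · simp
  simp_rw [h1]
  rw [integral_finsetSum]
  · refine Finset.sum_congr rfl fun i _ => ?_
    rw [integral_indicator_const _ (hm i), measureReal_restrict_apply (hm i),
      inter_eq_left.2 (hZ.subset i), Complex.real_smul]
  · intro i _
    rw [integrable_indicator_iff (hm i)]
    refine integrableOn_const ?_
    exact ((Measure.restrict_apply_le _ _).trans_lt (hZ.ne_top i).lt_top).ne

end Label

/-! ### Continuity of coherent vectors and an exponential limit -/

section Coherent

open Filter Topology

variable {H : Type*} [NormedAddCommGroup H] [InnerProductSpace ℂ H]

/-- Expanding $\|f(y)-f(x)\|^2$ leaves only inner products of values of $f$. -/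
theorem continuous_of_continuous_inner {X E : Type*} [TopologicalSpace X] [NormedAddCommGroup E]
    [InnerProductSpace ℂ E] {f : X → E} (hf : Continuous fun p : X × X => ⟪f p.1, f p.2⟫_ℂ) :
    Continuous f := by
  rw [continuous_iff_continuousAt]
  intro x
  rw [ContinuousAt, tendsto_iff_norm_sub_tendsto_zero]
  have h1 : ∀ y, ‖f y - f x‖ = Real.sqrt (⟪f y, f y⟫_ℂ - ⟪f y, f x⟫_ℂ - ⟪f x, f y⟫_ℂ +
      ⟪f x, f x⟫_ℂ).re := by
    intro y
    rw [norm_eq_sqrt_re_inner (𝕜 := ℂ), inner_sub_sub_self]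
    rfl
  simp_rw [h1]
  have h2 : Continuous fun y => ⟪f y, f y⟫_ℂ := hf.comp (continuous_id.prodMk continuous_id)
  have h3 : Continuous fun y => ⟪f y, f x⟫_ℂ := hf.comp (continuous_id.prodMk continuous_const)
  have h4 : Continuous fun y => ⟪f x, f y⟫_ℂ := hf.comp (continuous_const.prodMk continuous_id)
  refine Continuous.tendsto' ?_ _ _ (by simp)
  exact Real.continuous_sqrt.comp
    (Complex.continuous_re.comp (((h2.sub h3).sub h4).add continuous_const))

theorem continuous_coherent : Continuous (coherent : H → Fock H) := by
  refine continuous_of_continuous_inner ?_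
  simp_rw [inner_coherent, chi]
  fun_prop

/-- The (unnormalised) exponential vector. -/
def expVec (f : H) : Fock H := ((Real.exp (‖f‖ ^ 2 / 2) : ℝ) : ℂ) • coherent f

theorem inner_expVec (f g : H) : ⟪expVec f, expVec g⟫_ℂ = Complex.exp ⟪f, g⟫_ℂ := by
  rw [expVec, expVec, inner_smul_left, inner_smul_right, inner_coherent, Complex.conj_ofReal,
    Complex.ofReal_exp, Complex.ofReal_exp, ← Complex.exp_add, ← Complex.exp_add, chi]
  congr 1
  push_cast
  ring

theorem coherent_mem_of_expVec_mem {S : Submodule ℂ (Fock H)} {f : H} (hf : expVec f ∈ S) :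
    coherent f ∈ S := by
  have hne : ((Real.exp (‖f‖ ^ 2 / 2) : ℝ) : ℂ) ≠ 0 := by
    exact_mod_cast (Real.exp_pos _).ne'
  exact (S.smul_mem_iff hne).1 hf

theorem tendsto_mul_exp_div_sub_one (b : ℂ) :
    Tendsto (fun n : ℕ => (n : ℂ) * (Complex.exp (b / n) - 1)) atTop (𝓝 b) := by
  have h1 : HasDerivAt (fun z : ℂ => Complex.exp (b * z)) b 0 := by
    have := ((hasDerivAt_id (0 : ℂ)).const_mul b).cexp
    simpa using this
  have h2 := h1.tendsto_slope_zero
  have h3 : Tendsto (fun n : ℕ => ((n : ℂ))⁻¹) atTop (𝓝[≠] 0) := by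
    refine tendsto_nhdsWithin_iff.2 ⟨tendsto_inv_atTop_nhds_zero_nat (𝕜 := ℂ), ?_⟩
    filter_upwards [eventually_gt_atTop 0] with n hn
    simpa using hn.ne'
  refine (h2.comp h3).congr fun n => ?_
  simp [div_eq_mul_inv]

/-- The weights $c_qc'_{q'}$ have total sum $1$, so the base is $1+\beta/n+o(1/n)$ with $\beta$ the
weighted sum of the $b_{qq'}$. This is where affine, rather than linear, combinations are needed. -/
theorem tendsto_pow_sum_exp {Q Q' : Type*} [Fintype Q] [Fintype Q'] {c : Q → ℂ} {c' : Q' → ℂ}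
    (hc : ∑ q, c q = 1) (hc' : ∑ q, c' q = 1) (b : Q → Q' → ℂ) :
    Tendsto (fun n : ℕ => (∑ q, ∑ q', c q * c' q' * Complex.exp (b q q' / n)) ^ n) atTop
      (𝓝 (Complex.exp (∑ q, ∑ q', c q * c' q' * b q q'))) := by
  have hcc : ∑ q, ∑ q', c q * c' q' = 1 := by
    rw [← Finset.sum_mul_sum, hc, hc', one_mul]
  have h1 : Tendsto (fun n : ℕ => (n : ℂ) *
      ∑ q, ∑ q', c q * c' q' * (Complex.exp (b q q' / n) - 1)) atTop
      (𝓝 (∑ q, ∑ q', c q * c' q' * b q q')) := by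
    simp_rw [Finset.mul_sum]
    refine tendsto_finsetSum _ fun q _ => tendsto_finsetSum _ fun q' _ => ?_
    refine ((tendsto_mul_exp_div_sub_one (b q q')).const_mul (c q * c' q')).congr fun n => ?_
    ring
  refine (Complex.tendsto_one_add_pow_exp_of_tendsto h1).congr fun n => ?_
  congr 1
  simp_rw [mul_sub, mul_one, Finset.sum_sub_distrib, hcc]
  ring

end Coherent

/-! ### Totality of coherent vectors of simple paths -/

section Totality

open MeasureTheory Set Filter Topology

variable {k : Type*} [NormedAddCommGroup k] [InnerProductSpace ℂ k]

/-- The element of Fock space which corresponds to the tensor product, over the labels `l`, of the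
vectors `∑ q, c l q • expVec (x l q 1_{l})`. -/
def prodVec {L Q : Type*} [Fintype L] [Fintype Q] (J : Set ℝ) (W : SimpleFunc ℝ (Option L))
    (c : L → Q → ℂ) (x : L → Q → k) : FockOn k J :=
  open Classical in
  ∑ σ : L → Q, (∏ l, c l (σ l)) • expVec (toL2 J (labelFun W fun l => x l (σ l)))

/-- The exponential of a sum over labels factorises, and the sum over choice functions of a product
over labels is the product over labels of the sums. -/
theorem inner_prodVec {L Q Q' : Type*} [Fintype L] [Fintype Q] [Fintype Q'] {J : Set ℝ}
    {W : SimpleFunc ℝ (Option L)} (hW : IsLabelling J W)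
    (c : L → Q → ℂ) (x : L → Q → k) (c' : L → Q' → ℂ) (x' : L → Q' → k) :
    ⟪prodVec J W c x, prodVec J W c' x'⟫_ℂ = ∏ l, ∑ q, ∑ q', starRingEnd ℂ (c l q) * c' l q' *
      Complex.exp ((volume.real (W ⁻¹' {some l}) : ℝ) * ⟪x l q, x' l q'⟫_ℂ) := by
  classical
  simp only [prodVec, sum_inner, inner_sum]
  rw [Finset.prod_univ_sum, Fintype.piFinset_univ, Finset.sum_comm]
  refine Finset.sum_congr (by congr!) fun σ _ => ?_
  rw [Finset.prod_univ_sum, Fintype.piFinset_univ]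
  refine Finset.sum_congr (by congr!) fun σ' _ => ?_
  rw [inner_smul_left, inner_smul_right, inner_expVec, inner_labelFun hW, Complex.exp_sum,
    map_prod, ← mul_assoc, ← Finset.prod_mul_distrib, ← Finset.prod_mul_distrib]

/-- The last clause ensures that a step function for the old labels is also one for the new labels.
-/
theorem exists_refinement {ι : Type*} [Fintype ι] {J : Set ℝ} {Z : SimpleFunc ℝ (Option ι)}
    (hZ : IsLabelling J Z) (n : ℕ) :
    ∃ W : SimpleFunc ℝ (Option (ι × Fin (n + 1))), IsLabelling J W ∧
      (∀ l, volume.real (W ⁻¹' {some l}) = volume.real (Z ⁻¹' {some l.1}) / (n + 1)) ∧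
      ∀ s, (W s).map Prod.fst = Z s := by
  choose c hc using fun i => exists_equal_splitting n (Z.measurableSet_fiber (some i))
    (hZ.ne_top i)
  set W : SimpleFunc ℝ (Option (ι × Fin (n + 1))) :=
    Z.bind fun o => o.elim (SimpleFunc.const ℝ none) fun i => (c i).map fun j => some (i, j) with hW
  have hWs : ∀ s, W s = (Z s).map fun i => (i, c i s) := by
    intro s
    rw [hW, SimpleFunc.bind_apply]
    rcases Z s with _ | i <;> rfl
  have hfib : ∀ l, W ⁻¹' {some l} = Z ⁻¹' {some l.1} ∩ c l.1 ⁻¹' {l.2} := by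
    rintro ⟨i, j⟩
    ext s
    simp only [mem_preimage, mem_singleton_iff, hWs, mem_inter_iff, Option.map_eq_some_iff,
      Prod.mk.injEq]
    constructor
    · rintro ⟨i', h1, rfl, h2⟩
      exact ⟨h1, h2⟩
    · rintro ⟨h1, h2⟩
      exact ⟨i, h1, rfl, h2⟩
  refine ⟨W, ⟨fun l => ?_, fun l => ?_⟩, fun l => ?_, fun s => ?_⟩
  · rw [hfib]
    exact inter_subset_left.trans (hZ.subset l.1)
  · rw [hfib]
    exact measure_ne_top_of_subset inter_subset_left (hZ.ne_top l.1)
  · rw [hfib]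
    exact hc l.1 l.2
  · rw [hWs]
    cases Z s <;> rfl

/-- The $n+1$ equal pieces of the set labelled $i$ contribute equal factors, hence an $(n+1)$-st
power to which `tendsto_pow_sum_exp` applies. -/
theorem tendsto_inner_prodVec {ι Q Q' : Type*} [Fintype ι] [Fintype Q] [Fintype Q'] {J : Set ℝ}
    {Z : SimpleFunc ℝ (Option ι)} (hZ : IsLabelling J Z)
    {W : ∀ n, SimpleFunc ℝ (Option (ι × Fin (n + 1)))} (hW : ∀ n, IsLabelling J (W n))
    (hWv : ∀ n l, volume.real (W n ⁻¹' {some l}) = volume.real (Z ⁻¹' {some l.1}) / (n + 1))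
    {c : ι → Q → ℂ} {c' : ι → Q' → ℂ} (hc : ∀ i, ∑ q, c i q = 1) (hc' : ∀ i, ∑ q, c' i q = 1)
    (x : ι → Q → k) (x' : ι → Q' → k) :
    Tendsto (fun n => ⟪prodVec J (W n) (fun l => c l.1) (fun l => x l.1),
      prodVec J (W n) (fun l => c' l.1) (fun l => x' l.1)⟫_ℂ) atTop
      (𝓝 (Complex.exp ⟪toL2 J (labelFun Z fun i => ∑ q, c i q • x i q),
        toL2 J (labelFun Z fun i => ∑ q, c' i q • x' i q)⟫_ℂ)) := by
  have h1 : ∀ n, ⟪prodVec J (W n) (fun l => c l.1) (fun l => x l.1),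
      prodVec J (W n) (fun l => c' l.1) (fun l => x' l.1)⟫_ℂ =
      ∏ i, (∑ q, ∑ q', starRingEnd ℂ (c i q) * c' i q' * Complex.exp
        ((volume.real (Z ⁻¹' {some i}) : ℝ) * ⟪x i q, x' i q'⟫_ℂ / ((n + 1 : ℕ) : ℂ))) ^ (n + 1) := by
    intro n
    rw [inner_prodVec (hW n), Fintype.prod_prod_type]
    refine Finset.prod_congr rfl fun i _ => ?_
    simp only [hWv]
    rw [Finset.prod_const, Finset.card_univ, Fintype.card_fin]
    refine congrArg (· ^ (n + 1)) (Finset.sum_congr rfl fun q _ => Finset.sum_congr rfl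
      fun q' _ => ?_)
    congr 2
    push_cast
    ring
  simp_rw [h1]
  rw [inner_labelFun hZ, Complex.exp_sum]
  refine tendsto_finsetProd _ fun i _ => ?_
  have h2 := tendsto_pow_sum_exp (c := fun q => starRingEnd ℂ (c i q)) (c' := c' i)
    (by rw [← map_sum, hc, map_one]) (hc' i)
    (fun q q' => (volume.real (Z ⁻¹' {some i}) : ℝ) * ⟪x i q, x' i q'⟫_ℂ)
  have h3 := h2.comp (tendsto_add_atTop_nat 1)
  suffices hlim : ((volume.real (Z ⁻¹' {some i}) : ℝ) : ℂ) *
      ⟪∑ q, c i q • x i q, ∑ q, c' i q • x' i q⟫_ℂ = ∑ q, ∑ q', starRingEnd ℂ (c i q) * c' i q' *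
        ((volume.real (Z ⁻¹' {some i}) : ℝ) * ⟪x i q, x' i q'⟫_ℂ) by
    rw [hlim]
    exact h3
  simp only [sum_inner, inner_sum, inner_smul_left, inner_smul_right, Finset.mul_sum]
  rw [Finset.sum_comm]
  refine Finset.sum_congr rfl fun q _ => Finset.sum_congr rfl fun q' _ => ?_
  ring

theorem tendsto_of_tendsto_inner {E : Type*} [NormedAddCommGroup E] [InnerProductSpace ℂ E]
    {V : ℕ → E} {v : E} (h1 : Tendsto (fun n => ⟪V n, V n⟫_ℂ) atTop (𝓝 ⟪v, v⟫_ℂ))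
    (h2 : Tendsto (fun n => ⟪V n, v⟫_ℂ) atTop (𝓝 ⟪v, v⟫_ℂ)) : Tendsto V atTop (𝓝 v) := by
  rw [tendsto_iff_norm_sub_tendsto_zero]
  have h3 : ∀ n, ‖V n - v‖ = Real.sqrt (⟪V n, V n⟫_ℂ - ⟪V n, v⟫_ℂ - ⟪v, V n⟫_ℂ + ⟪v, v⟫_ℂ).re := by
    intro n
    rw [norm_eq_sqrt_re_inner (𝕜 := ℂ), inner_sub_sub_self]
    rfl
  have h4 : Tendsto (fun n => ⟪v, V n⟫_ℂ) atTop (𝓝 ⟪v, v⟫_ℂ) := by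
    have := (Complex.continuous_conj.tendsto _).comp h2
    simpa only [Function.comp_def, inner_conj_symm] using this
  simp_rw [h3]
  have h5 := (Real.continuous_sqrt.tendsto _).comp
    ((Complex.continuous_re.tendsto _).comp (((h1.sub h2).sub h4).add_const ⟪v, v⟫_ℂ))
  rw [sub_self, zero_sub, neg_add_cancel, Complex.zero_re, Real.sqrt_zero] at h5
  exact h5

variable {T : Set k}

/-- A `T`-valued simple function as a `k`-valued one. -/
def pathFun (F : SimpleFunc ℝ T) : SimpleFunc ℝ k := F.map fun x : T => (x : k)

theorem pathFun_apply (F : SimpleFunc ℝ T) (s : ℝ) : pathFun F s = F s := rfl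

variable (T) in
/-- The square-integrable `T`-valued simple functions on `ℝ₊`. -/
abbrev Path : Type _ :=
  {F : SimpleFunc ℝ T // MemLp (pathFun F) 2 (volume.restrict (Ici 0))}

/-- The closed linear span of the coherent vectors of `T`-valued simple functions. -/
def pathSpan (T : Set k) (J : Set ℝ) : Submodule ℂ (FockOn k J) :=
  (Submodule.span ℂ (Set.range fun F : Path T => coherent (toL2 J (pathFun F.1)))).topologicalClosure

theorem isClosed_pathSpan (T : Set k) (J : Set ℝ) :
    IsClosed (pathSpan T J : Set (FockOn k J)) := Submodule.isClosed_topologicalClosure _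

/-- The product vectors on the refinements are finite combinations of exponential vectors of
$T$-valued functions, and they converge in norm to the exponential vector of the affine combination.
-/
theorem expVec_mem_pathSpan_of_affine (h0 : (0 : k) ∈ T) {ι Q : Type*} [Fintype ι] [Fintype Q]
    {J : Set ℝ} {Z : SimpleFunc ℝ (Option ι)} (hZ : IsLabelling J Z) (x : Q → T) (c : ι → Q → ℂ)
    (hc : ∀ i, ∑ q, c i q = 1) :
    expVec (toL2 J (labelFun Z fun i => ∑ q, c i q • (x q : k))) ∈ pathSpan T J := by
  classical
  choose W hW hWv hWZ using exists_refinement hZ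
  set w : ι → k := fun i => ∑ q, c i q • (x q : k) with hw
  set f := toL2 J (labelFun Z w) with hf
  -- The target is itself a product vector with one term of weight $1$ per label, so one limit lemma
  -- covers both the norms and the inner products with the target.
  have hE : ∀ n, prodVec J (W n) (fun _ (_ : Unit) => (1 : ℂ)) (fun l _ => w l.1) = expVec f := by
    intro n
    have h1 : labelFun (W n) (fun l => w l.1) = labelFun Z w := by
      ext s
      change (W n s).elim 0 (fun l => w l.1) = (Z s).elim 0 w
      rw [← hWZ n s]
      rcases W n s with _ | l <;> rfl
    rw [prodVec]
    simp [h1, hf]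
  have h1 := tendsto_inner_prodVec hZ hW hWv hc hc (fun _ q => (x q : k)) (fun _ q => (x q : k))
  have h2 := tendsto_inner_prodVec hZ hW hWv (c' := fun _ (_ : Unit) => (1 : ℂ)) hc (by simp)
    (fun _ q => (x q : k)) (fun i _ => w i)
  simp only [hE, one_smul, Finset.univ_unique, Finset.sum_singleton] at h2
  have h3 : Tendsto (fun n => prodVec J (W n) (fun l => c l.1) (fun _ q => (x q : k))) atTop
      (𝓝 (expVec f)) := by
    refine tendsto_of_tendsto_inner ?_ ?_
    · rw [inner_expVec]
      exact h1
    · rw [inner_expVec]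
      exact h2
  refine (isClosed_pathSpan T J).mem_of_tendsto h3 (Filter.Eventually.of_forall fun n => ?_)
  refine Submodule.sum_mem _ fun σ _ => Submodule.smul_mem _ _ (Submodule.smul_mem _ _ ?_)
  -- Off the labelled sets the path takes the value $0\in T$, which keeps it square integrable.
  set F : SimpleFunc ℝ T := (W n).map fun o => o.elim ⟨0, h0⟩ fun l => x (σ l) with hF
  have hFe : pathFun F = labelFun (W n) fun l => (x (σ l) : k) := by
    ext s
    change (((W n s).elim ⟨0, h0⟩ fun l => x (σ l) : T) : k) = (W n s).elim 0 _
    rcases W n s with _ | l <;> rfl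
  refine Submodule.le_topologicalClosure _ (Submodule.subset_span ⟨⟨F, ?_⟩, ?_⟩)
  · rw [hFe]
    exact memLp_labelFun (hW n) _ Measure.restrict_le_self
  · simp only [hFe]

theorem coherent_labelFun_mem_pathSpan (hT : (Submodule.span ℂ T).topologicalClosure = ⊤)
    (h0 : (0 : k) ∈ T) {ι : Type*} [Fintype ι] {J : Set ℝ} {Z : SimpleFunc ℝ (Option ι)}
    (hZ : IsLabelling J Z) (w : ι → k) : coherent (toL2 J (labelFun Z w)) ∈ pathSpan T J := by
  classical
  have hcont : Continuous fun w : ι → k => coherent (toL2 J (labelFun Z w)) := by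
    refine continuous_coherent.comp (continuous_of_continuous_inner ?_)
    simp_rw [inner_labelFun hZ]
    fun_prop
  have hd : Dense (Set.pi univ fun _ : ι => (Submodule.span ℂ T : Set k)) :=
    dense_pi _ fun _ _ => Submodule.dense_iff_topologicalClosure_eq_top.2 hT
  have hcl : IsClosed {w : ι → k | coherent (toL2 J (labelFun Z w)) ∈ pathSpan T J} :=
    (isClosed_pathSpan T J).preimage hcont
  refine hcl.closure_subset_iff.2 ?_ (hd w)
  intro v hv
  choose l hl using fun i =>
    (Finsupp.mem_span_iff_linearCombination ℂ T (v i)).1 (show v i ∈ Submodule.span ℂ T from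
      hv i (mem_univ i))
  set z : T := ⟨0, h0⟩ with hz
  set S : Finset T := insert z (Finset.univ.biUnion fun i => (l i).support) with hS
  have hlS : ∀ i, ∑ q ∈ S, l i q • (q : k) = v i := by
    intro i
    rw [← hl i, Finsupp.linearCombination_apply, Finsupp.sum]
    refine (Finset.sum_subset ?_ fun q _ hq => ?_).symm
    · exact (Finset.subset_biUnion_of_mem (fun i => (l i).support) (Finset.mem_univ i)).trans
        (Finset.subset_insert _ _)
    · rw [Finsupp.notMem_support_iff.1 hq, zero_smul]
  have hzS : z ∈ S := Finset.mem_insert_self _ _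
  -- Giving the missing weight to $0\in T$ makes the coefficients sum to $1$ without changing the
  -- vector.
  have h1 := expVec_mem_pathSpan_of_affine h0 hZ (fun q : S => (q : T))
    (fun i q => l i q + if (q : T) = z then 1 - ∑ q ∈ S, l i q else 0) (fun i => by
      rw [Finset.sum_coe_sort S (fun q => l i q + if q = z then 1 - ∑ q ∈ S, l i q else 0),
        Finset.sum_add_distrib, Finset.sum_ite_eq' S z, if_pos hzS]
      ring)
  refine coherent_mem_of_expVec_mem (S := pathSpan T J) ?_
  convert! h1 using 5
  funext i
  rw [Finset.sum_coe_sort S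
    (fun q => (l i q + if q = z then 1 - ∑ q ∈ S, l i q else 0) • (q : k))]
  simp only [add_smul, ite_smul, zero_smul, Finset.sum_add_distrib, hlS]
  rw [Finset.sum_ite_eq' S z, if_pos hzS]
  simp [hz]

/-- The coherent vectors of `T`-valued simple functions are total if `T` is total and contains
`0`. -/
theorem total_coherent_path (hT : (Submodule.span ℂ T).topologicalClosure = ⊤)
    (h0 : (0 : k) ∈ T) {J : Set ℝ} (hJ : MeasurableSet J) :
    (Submodule.span ℂ (Set.range fun F : Path T =>
      coherent (toL2 J (pathFun F.1)))).topologicalClosure = ⊤ := by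
  classical
  change pathSpan T J = ⊤
  rw [eq_top_iff]
  intro ξ _
  refine mem_topologicalClosure_top (span_coherent_eq_top (H := L2 k J)) (isClosed_pathSpan T J) (fun f => ?_) ξ
  refine (Lp.simpleFunc.denseRange (E := k) (μ := volume.restrict J) (p := 2)
    (by simp)).induction_on (p := fun f => coherent f ∈ pathSpan T J) f
    ((isClosed_pathSpan T J).preimage continuous_coherent) fun g => ?_
  set φ := Lp.simpleFunc.toSimpleFunc g with hφ
  have hφm : MemLp φ 2 (volume.restrict J) := Lp.simpleFunc.memLp g
  have hg : toL2 J φ = (g : Lp k 2 (volume.restrict J)) := by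
    refine Lp.ext ?_
    filter_upwards [coeFn_toL2 hφm, Lp.simpleFunc.toSimpleFunc_eq_toFun g] with s h1 h2
    rw [h1, ← h2]
  -- Only nonzero values serve as labels: square integrability makes their level sets in $J$ of
  -- finite measure.
  set R : Finset k := φ.range.filter (· ≠ 0) with hR
  set Z : SimpleFunc ℝ (Option R) := SimpleFunc.piecewise J hJ
    (φ.map fun y => if h : y ∈ R then some ⟨y, h⟩ else none) (SimpleFunc.const ℝ none) with hZ
  have hfib : ∀ i : R, Z ⁻¹' {some i} = φ ⁻¹' {(i : k)} ∩ J := by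
    intro i
    ext s
    by_cases hs : s ∈ J
    · by_cases h : φ s ∈ R
      · simp [hZ, hs, h, Subtype.ext_iff]
      · have : φ s ≠ i := fun h' => h (h' ▸ i.2)
        simp [hZ, hs, h, this]
    · simp [hZ, hs]
  have hlab : IsLabelling J Z := by
    refine ⟨fun i => ?_, fun i => ?_⟩
    · rw [hfib]
      exact inter_subset_right
    · rw [hfib, ← Measure.restrict_apply (φ.measurableSet_fiber _)]
      exact (SimpleFunc.measure_preimage_lt_top_of_memLp (by simp) (by simp) φ hφm i
        (Finset.mem_filter.1 i.2).2).ne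
  have h1 := coherent_labelFun_mem_pathSpan hT h0 hlab (fun i : R => (i : k))
  rw [toL2_congr hJ (g := φ) (fun s hs => ?_) (memLp_labelFun hlab _ Measure.restrict_le_self),
    hg] at h1
  · exact h1
  · change (Z s).elim 0 (fun i : R => (i : k)) = φ s
    by_cases h : φ s ∈ R
    · simp [hZ, hs, h]
    · have : φ s = 0 := by
        by_contra h'
        exact h (Finset.mem_filter.2 ⟨φ.mem_range_self s, h'⟩)
      have h0R : (0 : k) ∉ R := this ▸ h
      simp [hZ, hs, this, h0R]

end Totality

/-! ### Matrix elements of adapted and shifted operators -/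

section Calculus

open MeasureTheory Set

variable {k : Type*} [NormedAddCommGroup k] [InnerProductSpace ℂ k]
  {h : Type*} [NormedAddCommGroup h] [InnerProductSpace ℂ h]

theorem eq_of_inner_eq {E : Type*} [NormedAddCommGroup E] [InnerProductSpace ℂ E] {a b : E}
    {c : ℂ} (h1 : ⟪a, a⟫_ℂ = c) (h2 : ⟪a, b⟫_ℂ = c) (h3 : ⟪b, a⟫_ℂ = c) (h4 : ⟪b, b⟫_ℂ = c) :
    a = b := by
  rw [← sub_eq_zero, ← inner_self_eq_zero (𝕜 := ℂ), inner_sub_sub_self, h1, h2, h3, h4]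
  ring

theorem measurePreserving_sub (t : ℝ≥0) :
    MeasurePreserving (fun s : ℝ => s - t) (volume.restrict (Ici (t : ℝ)))
      (volume.restrict (Ici 0)) := by
  have h := (measurePreserving_sub_right (volume : Measure ℝ) (t : ℝ)).restrict_preimage
    (measurableSet_Ici (a := (0 : ℝ)))
  have he : (fun s : ℝ => s - t) ⁻¹' Ici 0 = Ici (t : ℝ) := by
    ext s; simp
  rwa [he] at h

/-- Functions on `[0,t[` and on `[t,∞[` may be glued. -/
theorem exists_glue (t : ℝ≥0) (f : L2 k (Ico 0 (t : ℝ))) (g : L2 k (Ici 0)) :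
    ∃ f' : L2 k (Ici 0), restr (Ico_subset t) f' = f ∧ backShift t f' = g := by
  classical
  set F : ℝ → k := (Iio (t : ℝ)).piecewise f fun s => g (s - t) with hF
  have hm : MemLp F 2 (volume.restrict (Ici 0)) := by
    refine MemLp.piecewise measurableSet_Iio ?_ ?_
    · rw [Measure.restrict_restrict measurableSet_Iio, inter_comm, Ici_inter_Iio]
      exact Lp.memLp f
    · rw [Measure.restrict_restrict measurableSet_Iio.compl, compl_Iio, Ici_inter_Ici,
        max_eq_left (NNReal.coe_nonneg t)]
      exact (Lp.memLp g).comp_measurePreserving (measurePreserving_sub t)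
  have hm' := hm.mono_measure (Measure.restrict_mono (Ico_subset t) (le_refl volume))
  refine ⟨toL2 (Ici 0) F, ?_, ?_⟩
  · rw [restr_toL2 _ hm, toL2_congr measurableSet_Ico (g := f) (fun s hs => ?_) hm', toL2_coeFn]
    exact Set.piecewise_eq_of_mem _ _ _ hs.2
  · rw [backShift_toL2 t hm, toL2_congr measurableSet_Ici (g := g) (fun s hs => ?_)
      (memLp_shift t hm), toL2_coeFn]
    have hs0 : (0 : ℝ) ≤ s := hs
    rw [hF, Set.piecewise_eq_of_notMem _ _ _ (by simp [hs0]), add_sub_cancel_right]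

theorem restr_Ici_eq_of_backShift_eq {t : ℝ≥0} {f g : L2 k (Ici 0)}
    (hfg : backShift t f = backShift t g) :
    restr (Ici_subset t) f = restr (Ici_subset t) g := by
  refine eq_of_inner_eq (c := ⟪backShift t g, backShift t g⟫_ℂ) ?_ ?_ ?_ ?_ <;>
  simp only [← inner_backShift, hfg]

theorem inner_coherent_of_inner {H₁ H₂ : Type*} [NormedAddCommGroup H₁] [InnerProductSpace ℂ H₁]
    [NormedAddCommGroup H₂] [InnerProductSpace ℂ H₂] {a b : H₁} {a' b' : H₂}
    (haa : ⟪a, a⟫_ℂ = ⟪a', a'⟫_ℂ) (hab : ⟪a, b⟫_ℂ = ⟪a', b'⟫_ℂ) (hbb : ⟪b, b⟫_ℂ = ⟪b', b'⟫_ℂ) :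
    ⟪coherent a, coherent b⟫_ℂ = ⟪coherent a', coherent b'⟫_ℂ := by
  rw [inner_coherent, inner_coherent, chi_eq, chi_eq, haa, hab, hbb]

theorem inner_coherent_backShift (t : ℝ≥0) (f g : L2 k (Ici 0)) :
    ⟪coherent (backShift t f), coherent (backShift t g)⟫_ℂ =
      ⟪coherent (restr (Ici_subset t) f), coherent (restr (Ici_subset t) g)⟫_ℂ :=
  inner_coherent_of_inner (inner_backShift t f f) (inner_backShift t f g) (inner_backShift t g g)

theorem inner_coherent_split (t : ℝ≥0) (f g : L2 k (Ici 0)) :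
    ⟪coherent f, coherent g⟫_ℂ =
      ⟪coherent (restr (Ico_subset t) f), coherent (restr (Ico_subset t) g)⟫_ℂ *
      ⟪coherent (restr (Ici_subset t) f), coherent (restr (Ici_subset t) g)⟫_ℂ := by
  rw [inner_coherent, inner_coherent, inner_coherent, ← Complex.exp_add,
    ← chi_add (restr (Ico_subset t)) (restr (Ici_subset t)) (inner_split t) f g, neg_add]

theorem splitAt_htmul (t : ℝ≥0) (u : h) (f : L2 k (Ici 0)) :
    splitAt k h t (htmul u (coherent f)) =
      htmul (htmul u (coherent (restr (Ico_subset t) f))) (coherent (restr (Ici_subset t) f)) :=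
  gramIsometry_apply _ _ (span_htmul_eq_top _ span_coherent_eq_top) _ (u, f)

theorem shiftSplitAt_htmul (t : ℝ≥0) (u : h) (f : L2 k (Ici 0)) :
    shiftSplitAt k h t (htmul u (coherent f)) =
      htmul (htmul u (coherent (backShift t f))) (coherent (restr (Ico_subset t) f)) :=
  gramIsometry_apply _ _ (span_htmul_eq_top _ span_coherent_eq_top) _ (u, f)

theorem adjoint_isometry_apply {E F : Type*} [NormedAddCommGroup E] [InnerProductSpace ℂ E]
    [CompleteSpace E] [NormedAddCommGroup F] [InnerProductSpace ℂ F] [CompleteSpace F]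
    (U : E →ₗᵢ[ℂ] F) (x : E) : U.toContinuousLinearMap.adjoint (U x) = x := by
  refine ext_inner_left ℂ fun y => ?_
  rw [ContinuousLinearMap.adjoint_inner_right]
  exact U.inner_map_map y x

theorem adjoint_conj_comp {E F : Type*} [NormedAddCommGroup E] [InnerProductSpace ℂ E]
    [CompleteSpace E] [NormedAddCommGroup F] [InnerProductSpace ℂ F] [CompleteSpace F]
    (U : E →L[ℂ] F) (A : F →L[ℂ] F) :
    (U.adjoint ∘L A ∘L U).adjoint = U.adjoint ∘L A.adjoint ∘L U := by
  rw [ContinuousLinearMap.adjoint_comp, ContinuousLinearMap.adjoint_comp,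
    ContinuousLinearMap.adjoint_adjoint, ContinuousLinearMap.comp_assoc]

variable [CompleteSpace h]

theorem ketE_adjoint_htmul {F : Type*} [NormedAddCommGroup F] [InnerProductSpace ℂ F]
    (v w : F) (u : h) : (ketE v).adjoint (htmul u w) = ⟪v, w⟫_ℂ • u := by
  refine ext_inner_left ℂ fun y => ?_
  rw [ContinuousLinearMap.adjoint_inner_right, ketE_apply, inner_htmul, inner_smul_right, mul_comm]

theorem adaptedExt_adjoint (t : ℝ≥0) (Y : HTensor h (FockOn k (Ico 0 (t : ℝ))) →L[ℂ]
    HTensor h (FockOn k (Ico 0 (t : ℝ)))) : (adaptedExt t Y).adjoint = adaptedExt t Y.adjoint := by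
  rw [adaptedExt, adjoint_conj_comp, ampl_adjoint]
  rfl

theorem ccrFlow_adjoint (t : ℝ≥0)
    (A : HTensor h (FockOn k (Ici 0)) →L[ℂ] HTensor h (FockOn k (Ici 0))) :
    (ccrFlow t A).adjoint = ccrFlow t A.adjoint := by
  rw [ccrFlow, adjoint_conj_comp, ampl_adjoint]
  rfl

theorem adaptedExt_htmul (t : ℝ≥0) (Y : HTensor h (FockOn k (Ico 0 (t : ℝ))) →L[ℂ]
    HTensor h (FockOn k (Ico 0 (t : ℝ)))) (u : h) (f : L2 k (Ici 0)) :
    adaptedExt t Y (htmul u (coherent f)) = (splitAt k h t).toContinuousLinearMap.adjoint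
      (htmul (Y (htmul u (coherent (restr (Ico_subset t) f))))
        (coherent (restr (Ici_subset t) f))) := by
  rw [← ampl_htmul, ← splitAt_htmul]
  rfl

theorem ccrFlow_htmul (t : ℝ≥0)
    (A : HTensor h (FockOn k (Ici 0)) →L[ℂ] HTensor h (FockOn k (Ici 0))) (u : h)
    (f : L2 k (Ici 0)) :
    ccrFlow t A (htmul u (coherent f)) = (shiftSplitAt k h t).toContinuousLinearMap.adjoint
      (htmul (A (htmul u (coherent (backShift t f)))) (coherent (restr (Ico_subset t) f))) := by
  rw [← ampl_htmul, ← shiftSplitAt_htmul]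
  rfl

theorem inner_adaptedExt (t : ℝ≥0) (Y : HTensor h (FockOn k (Ico 0 (t : ℝ))) →L[ℂ]
    HTensor h (FockOn k (Ico 0 (t : ℝ)))) (u v : h) (f g : L2 k (Ici 0)) :
    ⟪htmul u (coherent f), adaptedExt t Y (htmul v (coherent g))⟫_ℂ =
      ⟪htmul u (coherent (restr (Ico_subset t) f)),
        Y (htmul v (coherent (restr (Ico_subset t) g)))⟫_ℂ *
      ⟪coherent (restr (Ici_subset t) f), coherent (restr (Ici_subset t) g)⟫_ℂ := by
  rw [adaptedExt_htmul, ContinuousLinearMap.adjoint_inner_right]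
  change ⟪splitAt k h t (htmul u (coherent f)), _⟫_ℂ = _
  rw [splitAt_htmul, inner_htmul]

/-- The two identifications of `h ⊗ 𝓕` with a tensor product are related by the exchange of the
factors `𝓕_{[0,t[}` and `𝓕_{[t,∞[}`. -/
theorem split_adjoint_comp_shiftSplit (t : ℝ≥0) (f g : L2 k (Ici 0)) :
    ((splitAt k h t).toContinuousLinearMap.adjoint ∘L
      ketE (coherent (restr (Ici_subset t) f))).adjoint ∘L
      ((shiftSplitAt k h t).toContinuousLinearMap.adjoint ∘L
        ketE (coherent (restr (Ico_subset t) g))) =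
    ketE (coherent (restr (Ico_subset t) g)) ∘L (ketE (coherent (backShift t f))).adjoint := by
  refine clm_eq_of_inner_total (span_htmul_eq_top _ span_coherent_eq_top)
    (span_htmul_eq_top _ span_coherent_eq_top) ?_
  rintro ⟨u, a⟩ ⟨w, b⟩
  -- The two identifications are used only as isometries, so their adjoints are evaluated on vectors
  -- in the range. Gluing exhibits the vectors at hand as images of $u\otimes\varphi(f')$ and
  -- $w\otimes\varphi(g')$.
  obtain ⟨f', hf1, hf2⟩ := exists_glue t a (backShift t f)
  obtain ⟨g', hg1, hg2⟩ := exists_glue t (restr (Ico_subset t) g) b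
  have h1 : (splitAt k h t).toContinuousLinearMap.adjoint
      (htmul (htmul u (coherent a)) (coherent (restr (Ici_subset t) f))) =
      htmul u (coherent f') := by
    rw [← restr_Ici_eq_of_backShift_eq hf2, ← hf1, ← splitAt_htmul, adjoint_isometry_apply]
  have h2 : (shiftSplitAt k h t).toContinuousLinearMap.adjoint
      (htmul (htmul w (coherent b)) (coherent (restr (Ico_subset t) g))) =
      htmul w (coherent g') := by
    rw [← hg1, ← hg2, ← shiftSplitAt_htmul, adjoint_isometry_apply]
  rw [ContinuousLinearMap.comp_apply, ContinuousLinearMap.adjoint_inner_right]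
  simp only [ContinuousLinearMap.comp_apply, ketE_apply]
  rw [h1, h2, ketE_adjoint_htmul, inner_htmul, inner_htmul, inner_smul_right,
    inner_coherent_split t, ← inner_coherent_backShift, hf1, hf2, hg1, hg2]
  ring

/-- $Y$ and the shifted $A$ act on different Fock factors and share only $h$. Pairing away the
future therefore turns $A$ into an operator on $h$, which acts before $Y$. -/
theorem inner_adaptedExt_ccrFlow (t : ℝ≥0) (Y : HTensor h (FockOn k (Ico 0 (t : ℝ))) →L[ℂ]
    HTensor h (FockOn k (Ico 0 (t : ℝ))))
    (A : HTensor h (FockOn k (Ici 0)) →L[ℂ] HTensor h (FockOn k (Ici 0))) (u v : h)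
    (f g : L2 k (Ici 0)) :
    ⟪htmul u (coherent f), adaptedExt t Y (ccrFlow t A (htmul v (coherent g)))⟫_ℂ =
      ⟪htmul u (coherent (restr (Ico_subset t) f)),
        Y (htmul ((ketE (coherent (backShift t f))).adjoint
          (A (htmul v (coherent (backShift t g))))) (coherent (restr (Ico_subset t) g)))⟫_ℂ := by
  rw [← ContinuousLinearMap.adjoint_inner_left, adaptedExt_adjoint, adaptedExt_htmul,
    ccrFlow_htmul]
  have h1 := DFunLike.congr_fun (split_adjoint_comp_shiftSplit (h := h) t f g)
    (A (htmul v (coherent (backShift t g))))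
  have h2 := congrArg (fun z => ⟪Y.adjoint (htmul u (coherent (restr (Ico_subset t) f))), z⟫_ℂ) h1
  rw [ContinuousLinearMap.comp_apply, ContinuousLinearMap.adjoint_inner_right,
    ContinuousLinearMap.adjoint_inner_left] at h2
  exact h2

end Calculus

/-! ### Bounds for the path kernel -/

section PathKernel

open MeasureTheory Set
open scoped ComplexOrder

variable {k : Type*} [NormedAddCommGroup k] [InnerProductSpace ℂ k] {T : Set k}

theorem memLp_pathFun_of_finite {A : Set ℝ} (hA : volume A ≠ ⊤) (F : SimpleFunc ℝ T) :
    MemLp (pathFun F) 2 (volume.restrict A) := by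
  have : IsFiniteMeasure (volume.restrict A) := ⟨by simpa using hA.lt_top⟩
  exact SimpleFunc.memLp_of_isFiniteMeasure _ _ _

variable (T) in
/-- The scalar semigroups `e^{-s χ(x, y)}`. -/
def expChi (x y : T) (s : ℝ≥0) : ℂ := Complex.exp (-((s : ℝ) : ℂ) * chi (x : k) (y : k))

theorem expChi_zero (x y : T) : expChi T x y 0 = 1 := by simp [expChi]

theorem expChi_add (x y : T) (s t : ℝ≥0) :
    expChi T x y (s + t) = expChi T x y s * expChi T x y t := by
  rw [expChi, expChi, expChi, ← Complex.exp_add]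
  congr 1
  push_cast
  ring

/-- The Gram kernel is $\exp(-\int_A\chi(F(s),G(s))\,ds)$, hence a path product of scalar
semigroups, and can be compared factor by factor with an operator-valued one. -/
theorem inner_coherent_path {A : Set ℝ} (hA : volume A ≠ ⊤) (F G : SimpleFunc ℝ T) :
    ⟪coherent (toL2 A (pathFun F)), coherent (toL2 A (pathFun G))⟫_ℂ =
      pathProd (expChi T) A F G := by
  have hF := memLp_pathFun_of_finite hA F
  have hG := memLp_pathFun_of_finite hA G
  rw [inner_coherent, chi_eq, inner_toL2 hF hF, inner_toL2 hF hG, inner_toL2 hG hG]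
  have h1 := integral_pair hA F G fun x _ => ⟪(x : k), (x : k)⟫_ℂ
  have h2 := integral_pair hA F G fun x y => ⟪(x : k), (y : k)⟫_ℂ
  have h3 := integral_pair hA F G fun _ y => ⟪(y : k), (y : k)⟫_ℂ
  simp only [pathFun_apply]
  rw [h1, h2, h3, ← Finset.sum_add_distrib, Finset.sum_div, ← Finset.sum_sub_distrib,
    ← Finset.sum_neg_distrib, Complex.exp_sum, pathProd]
  refine Finset.prod_congr rfl fun p _ => ?_
  rw [expChi, chi_eq]
  congr 1
  ring

variable {h : Type*} [NormedAddCommGroup h] [InnerProductSpace ℂ h] [CompleteSpace h]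
  {M : Type*} [CommMonoid M]

theorem opMatrix_one_nonneg {n : ℕ} : 0 ≤ opMatrix fun _ _ : Fin n => (1 : h →L[ℂ] h) := by
  rw [opMatrix_nonneg_iff]
  intro v
  have h1 : ∑ i, ∑ j, ⟪v i, (1 : h →L[ℂ] h) (v j)⟫_ℂ = ⟪∑ i, v i, ∑ j, v j⟫_ℂ := by
    simp only [sum_inner, inner_sum, one_apply_eq_self]
    exact Finset.sum_comm
  rw [h1, ← norm_sq_eq_inner]
  exact Complex.zero_le_real.2 (sq_nonneg _)

/-- Induction on the number of factors with the Schur product lemmas; commutativity of $M$ makes the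
entries of different factors commute. -/
theorem prod_mem_Icc {ι : Type*} {n : ℕ} (φ : M →* (h →L[ℂ] h)) (S : Finset ι)
    (a : ι → Fin n → Fin n → M) (e : ι → Fin n → Fin n → ℂ)
    (ha : ∀ z ∈ S, 0 ≤ opMatrix fun i j => φ (a z i j))
    (hae : ∀ z ∈ S, (opMatrix fun i j => φ (a z i j)) ≤
      opMatrix fun i j => e z i j • (1 : h →L[ℂ] h)) :
    0 ≤ (opMatrix fun i j => φ (∏ z ∈ S, a z i j)) ∧
    (opMatrix fun i j => φ (∏ z ∈ S, a z i j)) ≤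
      opMatrix fun i j => (∏ z ∈ S, e z i j) • (1 : h →L[ℂ] h) := by
  classical
  induction S using Finset.induction_on with
  | empty =>
    simp only [Finset.prod_empty, map_one, one_smul]
    exact ⟨opMatrix_one_nonneg, le_rfl⟩
  | insert z S hz ih =>
    obtain ⟨h1, h2⟩ := ih (fun w hw => ha w (Finset.mem_insert_of_mem hw))
      (fun w hw => hae w (Finset.mem_insert_of_mem hw))
    have h3 := ha z (Finset.mem_insert_self _ _)
    have h4 := hae z (Finset.mem_insert_self _ _)
    simp only [Finset.prod_insert hz, map_mul]
    have hc : ∀ i j p q, Commute (φ (a z i j)) (φ (∏ z ∈ S, a z p q)) := fun i j p q =>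
      (Commute.all _ _).map φ
    refine ⟨opMatrix_schur_nonneg h3 h1 hc, ?_⟩
    have h5 := opMatrix_schur_mono (h3.trans h4) h1 h4 h2 hc
      fun i j C => (Commute.one_left C).smul_left _
    simpa only [smul_mul_smul_comm, mul_one] using h5

theorem pathProd_mem_Icc {φ : M →* (h →L[ℂ] h)} {q : T → T → ℝ≥0 → M}
    (hq0 : ∀ x y, q x y 0 = 1) (hq : ∀ x y s t, q x y (s + t) = q x y s * q x y t)
    (hb : ∀ (n : ℕ), 1 ≤ n → ∀ (x : Fin n → T) (t : ℝ≥0),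
      0 ≤ (opMatrix fun i j => φ (q (x i) (x j) t)) ∧
      (opMatrix fun i j => φ (q (x i) (x j) t)) ≤ gramOp h t fun i => (x i : k))
    {A : Set ℝ} (hA : MeasurableSet A) (hAt : volume A ≠ ⊤) {n : ℕ} (F : Fin n → SimpleFunc ℝ T) :
    0 ≤ (opMatrix fun i j => φ (pathProd q A (F i) (F j))) ∧
    (opMatrix fun i j => φ (pathProd q A (F i) (F j))) ≤
      opMatrix fun i j => pathProd (expChi T) A (F i) (F j) • (1 : h →L[ℂ] h) := by
  rcases Nat.eq_zero_or_pos n with rfl | hn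
  -- The hypothesis starts at $n=1$; for $n=0$ the sums are empty.
  · rw [opMatrix_le_iff, opMatrix_nonneg_iff, opMatrix_nonneg_iff]
    simp
  · have h1 : ∀ i j, pathProd q A (F i) (F j) = ∏ z ∈ (jointPath F).range,
        q (z i) (z j) (volume (jointPath F ⁻¹' {z} ∩ A)).toNNReal := fun i j =>
      pathProd_eq_prod_label hq0 hq hA hAt (jointPath F) (fun z => z i) (fun z => z j)
        (fun _ => rfl) (fun _ => rfl)
    have h2 : ∀ i j, pathProd (expChi T) A (F i) (F j) = ∏ z ∈ (jointPath F).range,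
        expChi T (z i) (z j) (volume (jointPath F ⁻¹' {z} ∩ A)).toNNReal := fun i j =>
      pathProd_eq_prod_label expChi_zero expChi_add hA hAt (jointPath F) (fun z => z i)
        (fun z => z j) (fun _ => rfl) (fun _ => rfl)
    simp only [h1, h2]
    exact prod_mem_Icc φ _ _ _ (fun z _ => (hb n hn z _).1) fun z _ => (hb n hn z _).2

/-- The operators on `h ⊗ 𝓕_{[0,t[}` with prescribed matrix elements. -/
theorem exists_path_contraction (hT : (Submodule.span ℂ T).topologicalClosure = ⊤)
    (h0 : (0 : k) ∈ T) {φ : M →* (h →L[ℂ] h)} {q : T → T → ℝ≥0 → M}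
    (hq0 : ∀ x y, q x y 0 = 1) (hq : ∀ x y s t, q x y (s + t) = q x y s * q x y t)
    (hb : ∀ (n : ℕ), 1 ≤ n → ∀ (x : Fin n → T) (t : ℝ≥0),
      0 ≤ (opMatrix fun i j => φ (q (x i) (x j) t)) ∧
      (opMatrix fun i j => φ (q (x i) (x j) t)) ≤ gramOp h t fun i => (x i : k)) (t : ℝ≥0) :
    ∃ Y : HTensor h (FockOn k (Ico 0 (t : ℝ))) →L[ℂ] HTensor h (FockOn k (Ico 0 (t : ℝ))),
      Y.IsPositive ∧ ‖Y‖ ≤ 1 ∧ ∀ (F G : Path T) (u v : h),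
        ⟪htmul u (coherent (toL2 (Ico 0 (t : ℝ)) (pathFun F.1))),
          Y (htmul v (coherent (toL2 (Ico 0 (t : ℝ)) (pathFun G.1))))⟫_ℂ =
        ⟪u, φ (pathProd q (Ico 0 (t : ℝ)) F.1 G.1) v⟫_ℂ := by
  have htot : (Submodule.span ℂ (Set.range fun p : Path T × h =>
      ketE (coherent (toL2 (Ico 0 (t : ℝ)) (pathFun p.1.1))) p.2)).topologicalClosure = ⊤ := by
    rw [← span_htmul_eq_top (E := h) _ (total_coherent_path hT h0 (measurableSet_Ico
      (a := (0 : ℝ)) (b := t))), ← (Equiv.prodComm h (Path T)).surjective.range_comp]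
    rfl
  refine exists_contraction_of_kernel
    (fun F : Path T => ketE (coherent (toL2 (Ico 0 (t : ℝ)) (pathFun F.1)))) htot
    (fun F G => φ (pathProd q (Ico 0 (t : ℝ)) F.1 G.1)) (fun n F => ?_) (fun n F => ?_)
  · exact (pathProd_mem_Icc hq0 hq hb measurableSet_Ico (by simp) fun i => (F i).1).1
  · refine (pathProd_mem_Icc hq0 hq hb measurableSet_Ico (by simp) fun i => (F i).1).2.trans_eq ?_
    congr 1
    funext i j
    ext u
    rw [ContinuousLinearMap.comp_apply, ketE_apply, ketE_adjoint_htmul,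
      inner_coherent_path (by simp)]
    rfl

end PathKernel

/-! ### Construction of the cocycle -/

section Construction

open MeasureTheory Set

variable {k : Type*} [NormedAddCommGroup k] [InnerProductSpace ℂ k] {T : Set k}
  {h : Type*} [NormedAddCommGroup h] [InnerProductSpace ℂ h] [CompleteSpace h]

theorem adaptedExt_isPositive {t : ℝ≥0} {Y : HTensor h (FockOn k (Ico 0 (t : ℝ))) →L[ℂ]
    HTensor h (FockOn k (Ico 0 (t : ℝ)))} (hY : Y.IsPositive) : (adaptedExt t Y).IsPositive :=
  (ampl_isPositive _ hY).adjoint_conj _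

theorem norm_adaptedExt_le {t : ℝ≥0} {Y : HTensor h (FockOn k (Ico 0 (t : ℝ))) →L[ℂ]
    HTensor h (FockOn k (Ico 0 (t : ℝ)))} (hY : ‖Y‖ ≤ 1) : ‖adaptedExt t Y‖ ≤ 1 := by
  have h1 : ‖(splitAt k h t).toContinuousLinearMap‖ ≤ 1 := LinearIsometry.norm_toContinuousLinearMap_le _
  have h2 : ‖(splitAt k h t).toContinuousLinearMap.adjoint‖ ≤ 1 := by
    rwa [LinearIsometryEquiv.norm_map]
  refine (ContinuousLinearMap.opNorm_comp_le _ _).trans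
    (mul_le_one₀ h2 (norm_nonneg _) ((ContinuousLinearMap.opNorm_comp_le _ _).trans
      (mul_le_one₀ ((norm_ampl_le _ Y).trans hY) (norm_nonneg _) h1)))

/-- The path with value `x` on `[0,t[` and `0` elsewhere. -/
def stepPath (h0 : (0 : k) ∈ T) (t : ℝ≥0) (x : T) : SimpleFunc ℝ T :=
  open Classical in SimpleFunc.piecewise (Ico 0 (t : ℝ)) measurableSet_Ico (SimpleFunc.const ℝ x)
    (SimpleFunc.const ℝ ⟨0, h0⟩)

theorem stepPath_of_mem (h0 : (0 : k) ∈ T) {t : ℝ≥0} (x : T) {s : ℝ} (hs : s ∈ Ico 0 (t : ℝ)) :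
    stepPath h0 t x s = x := by
  simp only [stepPath, SimpleFunc.piecewise_apply, if_pos hs]
  rfl

theorem pathFun_stepPath (h0 : (0 : k) ∈ T) (t : ℝ≥0) (x : T) :
    (pathFun (stepPath h0 t x) : ℝ → k) = (Ico 0 (t : ℝ)).indicator fun _ => (x : k) := by
  classical
  ext s
  rw [pathFun_apply, stepPath, SimpleFunc.piecewise_apply, Set.indicator_apply]
  split_ifs <;> rfl

theorem memLp_step (t : ℝ≥0) (x : k) :
    MemLp ((Ico 0 (t : ℝ)).indicator fun _ => x) 2 (volume.restrict (Ici 0)) :=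
  memLp_indicator_const 2 measurableSet_Ico x
    (Or.inr ((Measure.restrict_apply_le _ _).trans_lt (by simp)).ne)

theorem stepVec_eq_pathFun (h0 : (0 : k) ∈ T) (t : ℝ≥0) (x : T) :
    stepVec t (x : k) = toL2 (Ici 0) (pathFun (stepPath h0 t x)) := by
  rw [pathFun_stepPath, stepVec_eq]

theorem restr_Ici_stepVec (t : ℝ≥0) (x : k) : restr (Ici_subset t) (stepVec t x) =
    toL2 (Ici (t : ℝ)) 0 := by
  rw [stepVec_eq, restr_toL2 _ (memLp_step t x)]
  refine toL2_congr measurableSet_Ici (fun s hs => ?_)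
    ((memLp_step t x).mono_measure (Measure.restrict_mono (Ici_subset t) le_rfl))
  exact Set.indicator_of_notMem (fun h' => absurd h'.2 (not_lt.2 hs)) _

theorem inner_coherent_restr_Ici_stepVec (t : ℝ≥0) (x y : k) :
    ⟪coherent (restr (Ici_subset t) (stepVec t x)),
      coherent (restr (Ici_subset t) (stepVec t y))⟫_ℂ = 1 := by
  rw [restr_Ici_stepVec, restr_Ici_stepVec, inner_coherent, chi]
  simp [inner_self_eq_norm_sq_to_K]

theorem inner_coherent_stepVec (t : ℝ≥0) (x y : k) :
    ⟪coherent (stepVec t x), coherent (stepVec t y)⟫_ℂ =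
      Complex.exp (-((t : ℝ) : ℂ) * chi x y) := by
  have h1 : ∀ x y : k, ⟪stepVec t x, stepVec t y⟫_ℂ = ((t : ℝ) : ℂ) * ⟪x, y⟫_ℂ := by
    intro x y
    rw [stepVec_eq, stepVec_eq, inner_toL2 (memLp_step t x) (memLp_step t y)]
    have h2 : ∀ s, ⟪(Ico 0 (t : ℝ)).indicator (fun _ => x) s,
        (Ico 0 (t : ℝ)).indicator (fun _ => y) s⟫_ℂ =
        (Ico 0 (t : ℝ)).indicator (fun _ => ⟪x, y⟫_ℂ) s := by
      intro s
      by_cases hs : s ∈ Ico 0 (t : ℝ)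
      · simp only [Set.indicator_of_mem hs]
      · simp only [Set.indicator_of_notMem hs, inner_zero_left]
    simp_rw [h2]
    rw [integral_indicator_const _ measurableSet_Ico,
      measureReal_restrict_apply measurableSet_Ico, inter_eq_left.2 (Ico_subset t),
      Real.volume_real_Ico_of_le (NNReal.coe_nonneg t), Complex.real_smul, sub_zero]
  rw [inner_coherent, chi_eq, chi_eq, h1, h1, h1]
  congr 1
  ring

theorem backShift_backShift_path (F : Path T) (r t : ℝ≥0) :
    backShift t (backShift r (toL2 (Ici 0) (pathFun F.1))) =
      backShift (r + t) (toL2 (Ici 0) (pathFun F.1)) := by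
  rw [backShift_toL2 r F.2, backShift_toL2 (r + t) F.2, backShift_toL2 t (memLp_shift r F.2)]
  congr 1
  funext s
  congr 1
  push_cast
  ring

/-- The shifted path. -/
def Path.shift (F : Path T) (r : ℝ≥0) : Path T := ⟨shiftPath r F.1, memLp_shift r F.2⟩

theorem Path.toL2_shift (F : Path T) (r : ℝ≥0) :
    toL2 (Ici 0) (pathFun (F.shift r).1) = backShift r (toL2 (Ici 0) (pathFun F.1)) := by
  rw [backShift_toL2 r F.2]
  rfl

theorem pathProd_zero {M : Type*} [CommMonoid M] {q : T → T → ℝ≥0 → M}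
    (hq0 : ∀ x y, q x y 0 = 1) (F G : SimpleFunc ℝ T) :
    pathProd q (Ico 0 ((0 : ℝ≥0) : ℝ)) F G = 1 := by
  refine Finset.prod_eq_one fun p _ => ?_
  have : occTime (Ico 0 ((0 : ℝ≥0) : ℝ)) F G p = 0 := by simp [occTime]
  rw [this, hq0]

section

variable {M : Type*} [CommMonoid M] {φ : M →* (h →L[ℂ] h)} {q : T → T → ℝ≥0 → M}
  {Y : ∀ t : ℝ≥0, HTensor h (FockOn k (Ico 0 (t : ℝ))) →L[ℂ] HTensor h (FockOn k (Ico 0 (t : ℝ)))}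

variable (φ q Y) in
/-- The operators `Y t` have the matrix elements prescribed by `q`. -/
def HasPathElements : Prop :=
  ∀ (t : ℝ≥0) (F G : Path T) (u v : h),
    ⟪htmul u (coherent (toL2 (Ico 0 (t : ℝ)) (pathFun F.1))),
      Y t (htmul v (coherent (toL2 (Ico 0 (t : ℝ)) (pathFun G.1))))⟫_ℂ =
    ⟪u, φ (pathProd q (Ico 0 (t : ℝ)) F.1 G.1) v⟫_ℂ

theorem HasPathElements.inner_restr (hY : HasPathElements φ q Y) (t : ℝ≥0) (F G : Path T)
    (u v : h) :
    ⟪htmul u (coherent (restr (Ico_subset t) (toL2 (Ici 0) (pathFun F.1)))),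
      Y t (htmul v (coherent (restr (Ico_subset t) (toL2 (Ici 0) (pathFun G.1)))))⟫_ℂ =
    ⟪u, φ (pathProd q (Ico 0 (t : ℝ)) F.1 G.1) v⟫_ℂ := by
  rw [restr_toL2 _ F.2, restr_toL2 _ G.2, hY]

theorem HasPathElements.inner_adaptedExt (hY : HasPathElements φ q Y) (t : ℝ≥0) (F G : Path T)
    (u v : h) :
    ⟪htmul u (coherent (toL2 (Ici 0) (pathFun F.1))),
      adaptedExt t (Y t) (htmul v (coherent (toL2 (Ici 0) (pathFun G.1))))⟫_ℂ =
    ⟪u, φ (pathProd q (Ico 0 (t : ℝ)) F.1 G.1) v⟫_ℂ *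
    ⟪coherent (backShift t (toL2 (Ici 0) (pathFun F.1))),
      coherent (backShift t (toL2 (Ici 0) (pathFun G.1)))⟫_ℂ := by
  rw [QSC.inner_adaptedExt, hY.inner_restr, inner_coherent_backShift]

theorem total_htmul_path (hT : (Submodule.span ℂ T).topologicalClosure = ⊤) (h0 : (0 : k) ∈ T) :
    (Submodule.span ℂ (Set.range fun p : h × Path T =>
      htmul p.1 (coherent (toL2 (Ici 0) (pathFun p.2.1))))).topologicalClosure = ⊤ :=
  span_htmul_eq_top (fun F : Path T => coherent (toL2 (Ici 0) (pathFun F.1)))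
    (total_coherent_path hT h0 measurableSet_Ici)

theorem HasPathElements.zero (hY : HasPathElements φ q Y)
    (hT : (Submodule.span ℂ T).topologicalClosure = ⊤) (h0 : (0 : k) ∈ T)
    (hq0 : ∀ x y, q x y 0 = 1) : adaptedExt 0 (Y 0) = 1 := by
  refine clm_eq_of_inner_total (total_htmul_path hT h0) (total_htmul_path hT h0) ?_
  rintro ⟨u, F⟩ ⟨v, G⟩
  rw [hY.inner_adaptedExt, pathProd_zero hq0, map_one, one_apply_eq_self, one_apply_eq_self,
    inner_htmul, inner_coherent_backShift, inner_coherent_split 0 (toL2 (Ici 0) (pathFun F.1)),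
    restr_toL2 (Ico_subset 0) F.2, restr_toL2 (Ico_subset 0) G.2, inner_coherent_path (by simp),
    pathProd_zero expChi_zero, one_mul]

/-- Identifies the operator on $h$ left by `inner_adaptedExt_ccrFlow`: the path product of the
shifted paths, times the overlap of the coherent vectors after time $r+t$. -/
theorem HasPathElements.ketE_adjoint (hY : HasPathElements φ q Y) (r t : ℝ≥0) (F G : Path T)
    (v : h) :
    (ketE (coherent (backShift r (toL2 (Ici 0) (pathFun F.1))))).adjoint
      (adaptedExt t (Y t) (htmul v (coherent (backShift r (toL2 (Ici 0) (pathFun G.1)))))) =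
    ⟪coherent (backShift (r + t) (toL2 (Ici 0) (pathFun F.1))),
      coherent (backShift (r + t) (toL2 (Ici 0) (pathFun G.1)))⟫_ℂ •
    φ (pathProd q (Ico 0 (t : ℝ)) (shiftPath r F.1) (shiftPath r G.1)) v := by
  refine ext_inner_left ℂ fun w => ?_
  rw [ContinuousLinearMap.adjoint_inner_right, ketE_apply, ← F.toL2_shift, ← G.toL2_shift,
    hY.inner_adaptedExt, F.toL2_shift, G.toL2_shift, backShift_backShift_path,
    backShift_backShift_path, inner_smul_right, mul_comm]
  rfl

theorem HasPathElements.add (hY : HasPathElements φ q Y)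
    (hT : (Submodule.span ℂ T).topologicalClosure = ⊤) (h0 : (0 : k) ∈ T)
    (hq0 : ∀ x y, q x y 0 = 1) (hq : ∀ x y s t, q x y (s + t) = q x y s * q x y t) (r t : ℝ≥0) :
    adaptedExt (r + t) (Y (r + t)) = adaptedExt r (Y r) * ccrFlow r (adaptedExt t (Y t)) := by
  refine clm_eq_of_inner_total (total_htmul_path hT h0) (total_htmul_path hT h0) ?_
  rintro ⟨u, F⟩ ⟨v, G⟩
  rw [mul_apply_eq_comp, inner_adaptedExt_ccrFlow, hY.ketE_adjoint, hY.inner_restr, map_smul,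
    inner_smul_right, hY.inner_adaptedExt, mul_comm, pathProd_add hq0 hq, map_mul]
  rfl

/-- Step paths are constant on $[0,t[$, so their product has one factor, and both vanish afterwards,
so the overlap there is $1$. -/
theorem HasPathElements.assocSemigroup_eq (hY : HasPathElements φ q Y) (h0 : (0 : k) ∈ T)
    (hq0 : ∀ x y, q x y 0 = 1) (x y : T) (t : ℝ≥0) :
    assocSemigroup (fun t => adaptedExt t (Y t)) (x : k) (y : k) t = φ (q x y t) := by
  ext v
  refine ext_inner_left ℂ fun u => ?_
  change ⟪u, (ketE (coherent (stepVec t (x : k)))).adjoint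
    (adaptedExt t (Y t) (ketE (coherent (stepVec t (y : k))) v))⟫_ℂ = _
  rw [ContinuousLinearMap.adjoint_inner_right, ketE_apply, ketE_apply]
  have hmem : ∀ x : T, MemLp (pathFun (stepPath h0 t x)) 2 (volume.restrict (Ici 0)) := by
    intro x
    rw [pathFun_stepPath]
    exact memLp_step t _
  have h1 := hY.inner_adaptedExt t ⟨stepPath h0 t x, hmem x⟩ ⟨stepPath h0 t y, hmem y⟩ u v
  rw [inner_coherent_backShift] at h1
  simp only [← stepVec_eq_pathFun] at h1
  rw [h1, inner_coherent_restr_Ici_stepVec, mul_one,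
    pathProd_const hq0 t x y (fun s hs => stepPath_of_mem h0 x hs)
      (fun s hs => stepPath_of_mem h0 y hs)]

theorem exists_leftCocycle (hT : (Submodule.span ℂ T).topologicalClosure = ⊤)
    (h0 : (0 : k) ∈ T) (hq0 : ∀ x y, q x y 0 = 1)
    (hq : ∀ x y s t, q x y (s + t) = q x y s * q x y t)
    (hb : ∀ (n : ℕ), 1 ≤ n → ∀ (x : Fin n → T) (t : ℝ≥0),
      0 ≤ (opMatrix fun i j => φ (q (x i) (x j) t)) ∧
      (opMatrix fun i j => φ (q (x i) (x j) t)) ≤ gramOp h t fun i => (x i : k)) :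
    ∃ X : ℝ≥0 → HTensor h (FockOn k (Ici 0)) →L[ℂ] HTensor h (FockOn k (Ici 0)),
      IsLeftCocycle X ∧ IsPositiveContractive X ∧
        ∀ (x y : T) (t : ℝ≥0), assocSemigroup X (x : k) (y : k) t = φ (q x y t) := by
  choose Y hYpos hYnorm hY using exists_path_contraction hT h0 hq0 hq hb
  have hY' : HasPathElements φ q Y := hY
  exact ⟨fun t => adaptedExt t (Y t), ⟨fun t => ⟨Y t, rfl⟩, hY'.zero hT h0 hq0,
    hY'.add hT h0 hq0 hq⟩, fun t => ⟨adaptedExt_isPositive (hYpos t),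
      norm_adaptedExt_le (hYnorm t)⟩, hY'.assocSemigroup_eq h0 hq0⟩

end

end Construction

/-! ### Necessity of commutation and of the bounds -/

section Converse

open Set
open scoped ComplexOrder

variable {k : Type*} [NormedAddCommGroup k] [InnerProductSpace ℂ k]
  {h : Type*} [NormedAddCommGroup h] [InnerProductSpace ℂ h] [CompleteSpace h]
  {X : ℝ≥0 → HTensor h (FockOn k (Ici 0)) →L[ℂ] HTensor h (FockOn k (Ici 0))}

theorem inner_assocSemigroup (x y : k) (t : ℝ≥0) (u v : h) :
    ⟪u, assocSemigroup X x y t v⟫_ℂ =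
      ⟪htmul u (coherent (stepVec t x)), X t (htmul v (coherent (stepVec t y)))⟫_ℂ := by
  change ⟪u, (ketE (coherent (stepVec t x))).adjoint
    (X t (ketE (coherent (stepVec t y)) v))⟫_ℂ = _
  rw [ContinuousLinearMap.adjoint_inner_right, ketE_apply, ketE_apply]

theorem IsPositiveContractive.adjoint_eq (hX : IsPositiveContractive X) (t : ℝ≥0) :
    (X t).adjoint = X t := (hX t).1.isSelfAdjoint.star_eq

theorem IsPositiveContractive.isRightCocycle_iff (hX : IsPositiveContractive X) :
    IsRightCocycle X ↔ IsLeftCocycle X := by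
  have h1 : ∀ r t, (X r * ccrFlow r (X t)).adjoint = ccrFlow r (X t) * X r := by
    intro r t
    change (X r ∘L ccrFlow r (X t)).adjoint = _
    rw [ContinuousLinearMap.adjoint_comp, ccrFlow_adjoint, hX.adjoint_eq, hX.adjoint_eq]
    rfl
  constructor
  · intro hR
    refine ⟨hR.process, hR.zero, fun r t => ?_⟩
    rw [← hX.adjoint_eq, hR.add, ← h1, ContinuousLinearMap.adjoint_adjoint]
  · intro hL
    refine ⟨hL.process, hL.zero, fun r t => ?_⟩
    rw [← hX.adjoint_eq, hL.add, h1]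

theorem IsPositiveContractive.assocSemigroup_adjoint (hX : IsPositiveContractive X) (x y : k)
    (t : ℝ≥0) : (assocSemigroup X x y t).adjoint = assocSemigroup X y x t := by
  ext v
  refine ext_inner_left ℂ fun u => ?_
  rw [ContinuousLinearMap.adjoint_inner_right, ← inner_conj_symm, inner_assocSemigroup,
    inner_assocSemigroup, inner_conj_symm, ← ContinuousLinearMap.adjoint_inner_right,
    hX.adjoint_eq]

/-- On two-step functions the past leg gives the semigroup at time $r$, and the future leg, shifted
back, the one at time $t$. -/
theorem IsLeftCocycle.inner_add (hX : IsLeftCocycle X) {r t : ℝ≥0} {x y x' y' : k}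
    {f g : L2 k (Ici 0)} (hf : restr (Ico_subset r) f = restr (Ico_subset r) (stepVec r x))
    (hf' : backShift r f = stepVec t x')
    (hg : restr (Ico_subset r) g = restr (Ico_subset r) (stepVec r y))
    (hg' : backShift r g = stepVec t y') (u v : h) :
    ⟪htmul u (coherent f), X (r + t) (htmul v (coherent g))⟫_ℂ =
      ⟪u, assocSemigroup X x y r (assocSemigroup X x' y' t v)⟫_ℂ := by
  obtain ⟨Y, hY⟩ := hX.process r
  have hw : (ketE (coherent (stepVec t x'))).adjoint
      (X t (htmul v (coherent (stepVec t y')))) = assocSemigroup X x' y' t v := rfl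
  rw [hX.add, mul_apply_eq_comp, inner_assocSemigroup, hY, inner_adaptedExt_ccrFlow, hf, hf', hg,
    hg', hw, inner_adaptedExt, inner_coherent_restr_Ici_stepVec, mul_one]

theorem IsLeftCocycle.commute_assocSemigroup (hX : IsLeftCocycle X)
    (hX' : IsPositiveContractive X) (x y x' y' : k) (r t : ℝ≥0) :
    Commute (assocSemigroup X x y r) (assocSemigroup X x' y' t) := by
  obtain ⟨f, hf, hf'⟩ := exists_glue r (restr (Ico_subset r) (stepVec r x)) (stepVec t x')
  obtain ⟨g, hg, hg'⟩ := exists_glue r (restr (Ico_subset r) (stepVec r y)) (stepVec t y')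
  rw [commute_iff_eq]
  ext v
  refine ext_inner_left ℂ fun u => ?_
  -- The matrix element of the self-adjoint $X_{r+t}$ is computed a second time with $f$ and $g$
  -- exchanged; taking adjoints reverses the product.
  rw [mul_apply_eq_comp, mul_apply_eq_comp, ← hX.inner_add hf hf' hg hg',
    ← ContinuousLinearMap.adjoint_inner_left, hX'.adjoint_eq, ← inner_conj_symm,
    hX.inner_add hg hg' hf hf', inner_conj_symm, ← ContinuousLinearMap.adjoint_inner_right,
    ← ContinuousLinearMap.adjoint_inner_right, hX'.assocSemigroup_adjoint,
    hX'.assocSemigroup_adjoint]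

/-- The form of the matrix at $v$ is that of $X_t$ at $\sum_iv_i\otimes\varphi((x_i)_{[0,t[})$, and
replacing $X_t$ by $1$ gives the form of the Gram matrix. -/
theorem IsPositiveContractive.opMatrix_mem_Icc (hX : IsPositiveContractive X) {n : ℕ}
    (x : Fin n → k) (t : ℝ≥0) :
    0 ≤ (opMatrix fun i j => assocSemigroup X (x i) (x j) t) ∧
    (opMatrix fun i j => assocSemigroup X (x i) (x j) t) ≤ gramOp h t x := by
  obtain ⟨hpos, hnorm⟩ := hX t
  have hle : X t ≤ 1 := (CStarAlgebra.norm_le_one_iff_of_nonneg _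
    ((ContinuousLinearMap.nonneg_iff_isPositive _).2 hpos)).1 hnorm
  set ξ : (PiLp 2 fun _ : Fin n => h) → HTensor h (FockOn k (Ici 0)) := fun v =>
    ∑ i, htmul (v i) (coherent (stepVec t (x i))) with hξ
  have hA : ∀ (A : HTensor h (FockOn k (Ici 0)) →L[ℂ] HTensor h (FockOn k (Ici 0)))
      (v : PiLp 2 fun _ : Fin n => h), ⟪ξ v, A (ξ v)⟫_ℂ = ∑ i, ∑ j,
        ⟪htmul (v i) (coherent (stepVec t (x i))),
          A (htmul (v j) (coherent (stepVec t (x j))))⟫_ℂ := by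
    intro A v
    simp only [hξ, map_sum, sum_inner, inner_sum]
    exact Finset.sum_comm
  constructor
  · rw [opMatrix_nonneg_iff]
    intro v
    simp only [inner_assocSemigroup]
    rw [← hA]
    exact hpos.inner_nonneg_right _
  · rw [gramOp, opMatrix_le_iff, opMatrix_nonneg_iff]
    intro v
    have h1 : ∀ i j, ⟪v i, (Complex.exp (-((t : ℝ) : ℂ) * chi (x i) (x j)) • (1 : h →L[ℂ] h) -
        assocSemigroup X (x i) (x j) t) (v j)⟫_ℂ =
        ⟪htmul (v i) (coherent (stepVec t (x i))),
          (1 - X t) (htmul (v j) (coherent (stepVec t (x j))))⟫_ℂ := by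
      intro i j
      rw [sub_apply, sub_apply, inner_sub_right, inner_sub_right, inner_assocSemigroup,
        one_apply_eq_self, inner_htmul, inner_coherent_stepVec, smul_apply, one_apply_eq_self,
        inner_smul_right, mul_comm]
    simp only [h1]
    rw [← hA]
    exact (ContinuousLinearMap.le_def _ _).1 hle |>.inner_nonneg_right _

end Converse

/-! ### Passage to a commutative monoid of operators -/

section Commuting

open scoped IsMulCommutative

variable {k : Type*} [NormedAddCommGroup k] [InnerProductSpace ℂ k] {T : Set k}
  {h : Type*} [NormedAddCommGroup h] [InnerProductSpace ℂ h] [CompleteSpace h]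

theorem exists_leftCocycle_of_commute (hT : (Submodule.span ℂ T).topologicalClosure = ⊤)
    (h0 : (0 : k) ∈ T) (Q : T → T → ℝ≥0 → h →L[ℂ] h) (hQ : ∀ x y, IsSemigroup (Q x y))
    (hc : ∀ (x y x' y' : T) (s t : ℝ≥0), Commute (Q x y s) (Q x' y' t))
    (hb : ∀ (n : ℕ), 1 ≤ n → ∀ (x : Fin n → T) (t : ℝ≥0),
      0 ≤ (opMatrix fun i j => Q (x i) (x j) t) ∧
      (opMatrix fun i j => Q (x i) (x j) t) ≤ gramOp h t fun i => (x i : k)) :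
    ∃ X : ℝ≥0 → HTensor h (FockOn k (Set.Ici 0)) →L[ℂ] HTensor h (FockOn k (Set.Ici 0)),
      IsLeftCocycle X ∧ IsPositiveContractive X ∧
        ∀ (x y : T) (t : ℝ≥0), assocSemigroup X (x : k) (y : k) t = Q x y t := by
  -- Unordered finite products need a commutative monoid, so the semigroups are lifted to the
  -- submonoid they generate, with $\varphi$ its inclusion.
  let S : Set (h →L[ℂ] h) := Set.range fun p : T × T × ℝ≥0 => Q p.1 p.2.1 p.2.2
  have : IsMulCommutative (Submonoid.closure S) :=
    Submonoid.isMulCommutative_closure _ (by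
      rintro _ ⟨p, rfl⟩ _ ⟨p', rfl⟩
      exact (hc _ _ _ _ _ _).eq)
  let φ : Submonoid.closure S →* (h →L[ℂ] h) :=
    { toFun := fun a => a
      map_one' := rfl
      map_mul' := fun _ _ => rfl }
  obtain ⟨q, hq⟩ : ∃ q : T → T → ℝ≥0 → Submonoid.closure S, ∀ x y t, φ (q x y t) = Q x y t :=
    ⟨fun x y t => ⟨Q x y t, Submonoid.subset_closure ⟨(x, y, t), rfl⟩⟩, fun _ _ _ => rfl⟩
  have hφ : Function.Injective φ := Subtype.val_injective
  simp only [← hq] at hb ⊢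
  refine exists_leftCocycle hT h0 (fun x y => hφ ?_) (fun x y s t => hφ ?_) hb
  · rw [hq, map_one, (hQ x y).zero]
  · rw [map_mul, hq, hq, hq, (hQ x y).add]

end Commuting

end QSC

end

theorem theorem5p7
    {h : Type*} [NormedAddCommGroup h] [InnerProductSpace ℂ h] [CompleteSpace h]
    {k : Type*} [NormedAddCommGroup k] [InnerProductSpace ℂ k] [CompleteSpace k]
    (T : Set k) (hT : (Submodule.span ℂ T).topologicalClosure = ⊤) (h0 : (0 : k) ∈ T)
    (Q : T → T → ℝ≥0 → h →L[ℂ] h) (hQ : ∀ x y, QSC.IsSemigroup (Q x y)) :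
    List.TFAE [
      (∃ X : ℝ≥0 → QSC.HTensor h (QSC.FockOn k (Set.Ici 0)) →L[ℂ]
            QSC.HTensor h (QSC.FockOn k (Set.Ici 0)),
        QSC.IsLeftCocycle X ∧ QSC.IsPositiveContractive X ∧
          ∀ (x y : T) (t : ℝ≥0), QSC.assocSemigroup X (x : k) (y : k) t = Q x y t),
      (∃ X : ℝ≥0 → QSC.HTensor h (QSC.FockOn k (Set.Ici 0)) →L[ℂ]
            QSC.HTensor h (QSC.FockOn k (Set.Ici 0)),
        QSC.IsRightCocycle X ∧ QSC.IsPositiveContractive X ∧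
          ∀ (x y : T) (t : ℝ≥0), QSC.assocSemigroup X (x : k) (y : k) t = Q x y t),
      ((∀ (x y x' y' : T) (s t : ℝ≥0), Commute (Q x y s) (Q x' y' t)) ∧
        ∀ (n : ℕ), 1 ≤ n → ∀ (x : Fin n → T) (t : ℝ≥0),
          0 ≤ QSC.opMatrix (fun i j => Q (x i) (x j) t) ∧
          QSC.opMatrix (fun i j => Q (x i) (x j) t) ≤ QSC.gramOp h t (fun i => (x i : k)))] := by
  tfae_have 1 ↔ 2 :=
    ⟨fun ⟨X, hL, hX, hXQ⟩ => ⟨X, hX.isRightCocycle_iff.2 hL, hX, hXQ⟩,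
      fun ⟨X, hR, hX, hXQ⟩ => ⟨X, hX.isRightCocycle_iff.1 hR, hX, hXQ⟩⟩
  tfae_have 1 → 3 := by
    rintro ⟨X, hL, hX, hXQ⟩
    refine ⟨fun x y x' y' s t => ?_, fun n _ x t => ?_⟩
    · rw [← hXQ, ← hXQ]
      exact hL.commute_assocSemigroup hX _ _ _ _ _ _
    · simp only [← hXQ]
      exact hX.opMatrix_mem_Icc (fun i => (x i : k)) t
  tfae_have 3 → 1 := fun ⟨hc, hb⟩ => QSC.exists_leftCocycle_of_commute hT h0 Q hQ hc hb
  tfae_finish
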